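/- Conventions. For a real polynomial $f$ in two variables let $II_f=f_{xx}\,dx^2+2f_{xy}\,dx\,dy+f_{yy}\,dy^2$. Call $f$ hyperbolic (resp. elliptic) if $f_{xy}^2-f_{xx}f_{yy}$ is positive (resp. negative) at every point of $\mathbb R^2\setminus\{0\}$. For hyperbolic $f$, a field of asymptotic lines of $f$ is a continuous field of lines $L$ on $\mathbb R^2\setminus\{0\}$ such that $II_f(p)$ vanishes on $L(p)$ for every $p\neq 0$; it is regarded as a field on $\mathbb R^2$ with a singularity at the origin. Two such fields $L$, $M$ are topologically equivalent on $\mathbb R^2$ if there is a homeomorphism $H:\mathbb R^2\to\mathbb R^2$ with $H(0)=0$ that carries the (maximal, unparametrized) integral curves of $L$ in $\mathbb R^2\setminus\{0\}$ onto those of $M$. The index of $L$ at the origin is $\frac1{2\pi}$ times the total change of a continuously chosen angle between a constant vector field and $L$ along any closed curve in $\mathbb R^2\setminus\{0\}$ that goes once around the origin in the positive sense. Statement. Let $P,Q\in\mathbb R[x,y]$ be homogeneous polynomials such that $P$ is hyperbolic, $Q$ is elliptic, $Q>0$ on $\mathbb R^2\setminus\{0\}$, and $f=PQ$ is hyperbolic.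 Suppose that at every point of $\mathbb R^2$ $$P_{xx}P_yQ_y+P_{yy}P_xQ_x-P_{xy}(P_xQ_y+P_yQ_x)\le 0 .$$ Then $f$ and $P$ have fields of asymptotic lines, every field of asymptotic lines of $f$ is topologically equivalent on $\mathbb R^2$ to every field of asymptotic lines of $P$, and their indices at the origin exist, are half-integers $\frac n2$ with $n\in\mathbb Z$, and coincide. -/

import Mathlib

open Topology

/-- The real plane. Only its topology and differentiable structure are used below, so the choice of
norm is immaterial. -/
abbrev Plane : Type := Fin 2 → ℝ

/-- The Hessian matrix of the polynomial `f` at the point `p`. -/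
noncomputable def hess (f : MvPolynomial (Fin 2) ℝ) (p : Plane) : Matrix (Fin 2) (Fin 2) ℝ :=
  Matrix.of fun i j => MvPolynomial.eval p (MvPolynomial.pderiv i (MvPolynomial.pderiv j f))

/-- The second fundamental form of `f` at `p`, evaluated on the tangent vector `v`:
`f_xx dx² + 2 f_xy dx dy + f_yy dy²`. -/
noncomputable def secondForm (f : MvPolynomial (Fin 2) ℝ) (p v : Plane) : ℝ :=
  hess f p 0 0 * v 0 ^ 2 + 2 * hess f p 0 1 * v 0 * v 1 + hess f p 1 1 * v 1 ^ 2

/-- The discriminant `f_xy² - f_xx f_yy` of the second fundamental form. -/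
noncomputable def discr (f : MvPolynomial (Fin 2) ℝ) (p : Plane) : ℝ :=
  hess f p 0 1 ^ 2 - hess f p 0 0 * hess f p 1 1

/-- Every point of the graph of `f` off the origin is hyperbolic. -/
def IsHyperbolicPoly (f : MvPolynomial (Fin 2) ℝ) : Prop :=
  ∀ p : Plane, p ≠ 0 → 0 < discr f p

/-- Every point of the graph of `f` off the origin is elliptic. -/
def IsEllipticPoly (f : MvPolynomial (Fin 2) ℝ) : Prop :=
  ∀ p : Plane, p ≠ 0 → discr f p < 0

/-- The Hamiltonian vector field `(f_y, -f_x)`. -/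
noncomputable def hamiltonianField (f : MvPolynomial (Fin 2) ℝ) (p : Plane) : Plane :=
  ![MvPolynomial.eval p (MvPolynomial.pderiv 1 f), -MvPolynomial.eval p (MvPolynomial.pderiv 0 f)]

/-- The quantity `∇P · Hess P · ∇Qᵗ` at `p`, where `∇` is the Hamiltonian vector field. -/
noncomputable def hessPairing (P Q : MvPolynomial (Fin 2) ℝ) (p : Plane) : ℝ :=
  hamiltonianField P p ⬝ᵥ Matrix.mulVec (hess P p) (hamiltonianField Q p)

/-- `L` is a continuous field of lines on the punctured plane: near every point other than the
origin it is spanned by a continuous vector field without zeros. The origin is the singularity of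
the field; the value `L 0` carries no information and is never used. -/
def IsLineField (L : Plane → Submodule ℝ Plane) : Prop :=
  ∀ p : Plane, p ≠ 0 → ∃ U ∈ 𝓝 p, ∃ v : Plane → Plane, ContinuousOn v U ∧
    ∀ q ∈ U, v q ≠ 0 ∧ L q = Submodule.span ℝ {v q}

/-- `L` is a field of asymptotic lines of `f`, with a singularity at the origin. -/
def IsAsymptoticField (f : MvPolynomial (Fin 2) ℝ) (L : Plane → Submodule ℝ Plane) : Prop :=
  IsLineField L ∧ ∀ p : Plane, p ≠ 0 → ∀ v ∈ L p, secondForm f p v = 0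

/-- `γ`, restricted to the open interval `I`, is a regular `C¹` curve in the punctured plane which
is everywhere tangent to the line field `L`. -/
structure IsFieldCurve (L : Plane → Submodule ℝ Plane) (I : Set ℝ) (γ : ℝ → Plane) : Prop where
  isOpen : IsOpen I
  ordConnected : I.OrdConnected
  contDiffOn : ContDiffOn ℝ 1 γ I
  ne_zero : ∀ t ∈ I, γ t ≠ 0
  deriv_ne_zero : ∀ t ∈ I, deriv γ t ≠ 0
  deriv_mem : ∀ t ∈ I, deriv γ t ∈ L (γ t)

/-- The leaf through `p` of the foliation of `L`, that is, the maximal (unparametrized) integral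
curve through `p`: the union of the images of all integral curves through `p`. -/
def leaf (L : Plane → Submodule ℝ Plane) (p : Plane) : Set Plane :=
  {q | ∃ (I : Set ℝ) (γ : ℝ → Plane), IsFieldCurve L I γ ∧ p ∈ γ '' I ∧ q ∈ γ '' I}

/-- Topological equivalence on the whole plane of two line fields with a singularity at the origin:
a homeomorphism of the plane which preserves the singularity and carries the integral curves of the
first field onto those of the second. -/
def TopEquivalent (L M : Plane → Submodule ℝ Plane) : Prop :=
  ∃ H : Plane ≃ₜ Plane, H 0 = 0 ∧ ∀ p : Plane, p ≠ 0 → H '' leaf L p = leaf M (H p)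

/-- The vector with polar coordinates `(r, a)`. -/
noncomputable def polar (r a : ℝ) : Plane := ![r * Real.cos a, r * Real.sin a]

/-- `Γ : [0, 1] → ℝ²` is a closed curve in the punctured plane that goes once around the origin in
the positive sense: it has continuous polar coordinates, the radius returns to its initial value
and the polar angle increases by `2π`. -/
def IsPositiveLoop (Γ : ℝ → Plane) : Prop :=
  ∃ ρ α : ℝ → ℝ, ContinuousOn ρ (Set.Icc 0 1) ∧ ContinuousOn α (Set.Icc 0 1) ∧
    (∀ t ∈ Set.Icc (0 : ℝ) 1, 0 < ρ t ∧ Γ t = polar (ρ t) (α t)) ∧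
    ρ 1 = ρ 0 ∧ α 1 = α 0 + 2 * Real.pi

/-- The line field `L` has index `i` at the origin: along every closed curve that goes once around
the origin in the positive sense, the angle `θ` from the first coordinate vector field to `L`,
followed continuously, changes in total by `2π i`. -/
def HasIndex (L : Plane → Submodule ℝ Plane) (i : ℝ) : Prop :=
  ∀ Γ : ℝ → Plane, IsPositiveLoop Γ →
    ∃ θ : ℝ → ℝ, ContinuousOn θ (Set.Icc 0 1) ∧
      (∀ t ∈ Set.Icc (0 : ℝ) 1, L (Γ t) = Submodule.span ℝ {polar 1 (θ t)}) ∧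
      θ 1 - θ 0 = 2 * Real.pi * i

/-! Let `F` be the restriction to the unit circle of a homogeneous hyperbolic polynomial of degree
`m`. In the polar frame its Hessian is `r ^ (m - 2)` times the matrix with rows `(m (m - 1) F, (m -
1) F')` and `((m - 1) F', C)`, where `C = F'' + m F`. Hence an asymptotic line at polar angle `a`
has a direction `a - Ψ a` that does not depend on the radius. It is radial exactly where `F = 0`,
and there `Ψ' = m / 2 > 0`: the angle `Ψ` crosses the multiples of `π` only upwards (`IsPhase`).
Over one turn `Ψ` gains `N π`, where `-N` is the winding number of the curve `(F, F')`
(`IsHyperbolicTrace.exists_phase`). Since `F` must vanish somewhere, there is a crossing, so `N > 0`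
(`IsHyperbolicTrace.winding_neg`).

The integer `N` determines everything. The index is `1 - N / 2` (`HasRadialAngle.hasIndex`). The
rays with `Ψ ∈ ℤ π` cut the angular covering into sectors. In each sector the leaves are level
curves of `r w(a)`, with `w` positive and tending to `0` at both bounding rays. So each sector is a
half-plane foliated by horizontal lines, and explicit homogeneous coordinates make these half-planes
fit together along the rays (`HasRadialAngle.isHorizontalModel`). Two fields with the same `N` have
the same model and are therefore equivalent (`IsHorizontalModel.topEquivalent`).

It remains to compare `P` with `P Q`. If `q > 0` is the trace of `Q`, the curves `(F, F')` and `(F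
q, F' q + F q')` never point in opposite directions, so they have the same winding number
(`hasWinding_jetCurve_mul`). -/

/-! ### Polar coordinates and homogeneous homeomorphisms of the plane. -/

/-- The identification of the plane with the complex numbers. -/
noncomputable def planeToComplex (p : Plane) : ℂ := ⟨p 0, p 1⟩

theorem continuous_planeToComplex : Continuous planeToComplex := by
  have : planeToComplex = fun p : Plane => (p 0 : ℂ) + (p 1 : ℂ) * Complex.I := by
    funext p
    apply Complex.ext <;> simp [planeToComplex]
  rw [this]
  fun_prop

theorem planeToComplex_injective : Function.Injective planeToComplex := by
  intro p q h
  have h0 := congrArg Complex.re h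
  have h1 := congrArg Complex.im h
  ext i
  fin_cases i
  · simpa [planeToComplex] using h0
  · simpa [planeToComplex] using h1

@[simp] theorem planeToComplex_zero : planeToComplex 0 = 0 := by
  apply Complex.ext <;> simp [planeToComplex]

theorem planeToComplex_eq_zero {p : Plane} : planeToComplex p = 0 ↔ p = 0 := by
  rw [← planeToComplex_zero, planeToComplex_injective.eq_iff]

theorem planeToComplex_polar (r a : ℝ) :
    planeToComplex (polar r a) = r * Complex.exp (a * Complex.I) := by
  apply Complex.ext <;>
    simp [planeToComplex, polar, Complex.exp_ofReal_mul_I_re, Complex.exp_ofReal_mul_I_im]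

theorem polar_norm_arg (p : Plane) :
    polar ‖planeToComplex p‖ (Complex.arg (planeToComplex p)) = p := by
  apply planeToComplex_injective
  rw [planeToComplex_polar, Complex.norm_mul_exp_arg_mul_I]

@[simp] theorem polar_zero (a : ℝ) : polar 0 a = 0 := by
  ext i
  fin_cases i <;> simp [polar]

theorem polar_ne_zero {r : ℝ} (hr : 0 < r) (a : ℝ) : polar r a ≠ 0 := by
  rw [Ne, ← planeToComplex_eq_zero, planeToComplex_polar]
  simp [hr.ne']

theorem exists_polar {p : Plane} (hp : p ≠ 0) : ∃ r a : ℝ, 0 < r ∧ p = polar r a :=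
  ⟨_, _, norm_pos_iff.2 (planeToComplex_eq_zero.not.2 hp), (polar_norm_arg p).symm⟩

theorem polar_eq_polar_iff {r r' a a' : ℝ} (hr : 0 < r) (hr' : 0 < r') :
    polar r a = polar r' a' ↔ r = r' ∧ ∃ n : ℤ, a = a' + n * (2 * Real.pi) := by
  constructor
  · intro h
    have hc := congrArg planeToComplex h
    rw [planeToComplex_polar, planeToComplex_polar] at hc
    have hn := congrArg norm hc
    simp only [norm_mul, Complex.norm_real, Complex.norm_exp_ofReal_mul_I, mul_one, Real.norm_eq_abs,
      abs_of_pos hr, abs_of_pos hr'] at hn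
    refine ⟨hn, ?_⟩
    subst hn
    have he := mul_left_cancel₀ (Complex.ofReal_ne_zero.2 hr.ne') hc
    obtain ⟨n, hn⟩ := Complex.exp_eq_exp_iff_exists_int.1 he
    refine ⟨n, ?_⟩
    have := congrArg Complex.im hn
    simpa using this
  · rintro ⟨rfl, n, rfl⟩
    ext i
    fin_cases i <;> simp [polar, Real.cos_add_int_mul_two_pi, Real.sin_add_int_mul_two_pi]

theorem continuous_polar : Continuous fun x : ℝ × ℝ => polar x.1 x.2 := by
  refine continuous_pi fun i => ?_
  fin_cases i
  · simp only [polar]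
    exact continuous_fst.mul (Real.continuous_cos.comp continuous_snd)
  · simp only [polar]
    exact continuous_fst.mul (Real.continuous_sin.comp continuous_snd)

theorem map_add_int_mul {h : ℝ → ℝ} {c d : ℝ} (hh : ∀ x, h (x + c) = h x + d) (x : ℝ) (n : ℤ) :
    h (x + n * c) = h x + n * d := by
  induction n using Int.induction_on generalizing x with
  | zero => simp
  | succ i ih =>
    have : x + ((i : ℤ) + 1 : ℤ) * c = (x + (i : ℤ) * c) + c := by push_cast; ring
    rw [this, hh, ih]; push_cast; ring
  | pred i ih =>
    have h1 := hh (x + (-(i : ℤ) - 1 : ℤ) * c)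
    have : x + (-(i : ℤ) - 1 : ℤ) * c + c = x + (-(i : ℤ) : ℤ) * c := by push_cast; ring
    rw [this, ih] at h1
    push_cast at h1 ⊢
    linarith

/-- The map of the plane which in polar coordinates is `(r, a) ↦ (r * k a, h a)`. -/
noncomputable def polarMap (k h : ℝ → ℝ) (p : Plane) : Plane :=
  polar (‖planeToComplex p‖ * k (planeToComplex p).arg) (h (planeToComplex p).arg)

theorem polarMap_zero (k h : ℝ → ℝ) : polarMap k h 0 = 0 := by
  simp [polarMap]

theorem polarMap_polar {k h : ℝ → ℝ} (hk : ∀ a, k (a + 2 * Real.pi) = k a)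
    (hh : ∀ a, h (a + 2 * Real.pi) = h a + 2 * Real.pi) {r : ℝ} (hr : 0 < r) (hkp : ∀ a, 0 < k a)
    (a : ℝ) : polarMap k h (polar r a) = polar (r * k a) (h a) := by
  have hz := norm_pos_iff.2 (planeToComplex_eq_zero.not.2 (polar_ne_zero hr a))
  obtain ⟨h1, n, h2⟩ := (polar_eq_polar_iff hz hr).1 (polar_norm_arg (polar r a))
  have hk' := map_add_int_mul (h := k) (c := 2 * Real.pi) (d := 0) (by simpa using hk) a n
  have hh' := map_add_int_mul hh a n
  rw [polarMap, h1, h2, hk', hh', mul_zero, add_zero]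
  exact (polar_eq_polar_iff (mul_pos hr (hkp a)) (mul_pos hr (hkp a))).2 ⟨rfl, n, rfl⟩

theorem continuous_polarMap {k h : ℝ → ℝ} (hk : ∀ a, k (a + 2 * Real.pi) = k a)
    (hh : ∀ a, h (a + 2 * Real.pi) = h a + 2 * Real.pi) (hkp : ∀ a, 0 < k a)
    (hkc : Continuous k) (hhc : Continuous h) : Continuous (polarMap k h) := by
  rw [continuous_iff_continuousAt]
  intro p
  by_cases hp : p = 0
  · subst hp
    -- A continuous periodic `k` is bounded, which gives continuity at the origin, where the angle
    -- is undefined.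
    obtain ⟨C, hC⟩ := (Function.Periodic.isBounded_of_continuous (f := k) hk
      (by positivity) hkc).exists_norm_le
    rw [ContinuousAt, polarMap_zero]
    have hbound : ∀ q, ‖polarMap k h q‖ ≤ ‖planeToComplex q‖ * C := by
      intro q
      have hC0 := hC _ (Set.mem_range_self (planeToComplex q).arg)
      rw [Real.norm_eq_abs, abs_of_pos (hkp _)] at hC0
      have h0 : 0 ≤ ‖planeToComplex q‖ := norm_nonneg _
      have h1 : 0 ≤ ‖planeToComplex q‖ * k (planeToComplex q).arg := mul_nonneg h0 (hkp _).le
      have h2 := mul_le_mul_of_nonneg_left hC0 h0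
      refine (pi_norm_le_iff_of_nonneg (h1.trans h2)).2 fun i => ?_
      refine le_trans ?_ h2
      fin_cases i
      · simpa [polarMap, polar, abs_mul, abs_of_pos (hkp _)] using
          mul_le_mul_of_nonneg_left (Real.abs_cos_le_one (h (planeToComplex q).arg)) h1
      · simpa [polarMap, polar, abs_mul, abs_of_pos (hkp _)] using
          mul_le_mul_of_nonneg_left (Real.abs_sin_le_one (h (planeToComplex q).arg)) h1
    refine squeeze_zero_norm hbound ?_
    have : Continuous fun q => ‖planeToComplex q‖ * C := by
      have := continuous_planeToComplex
      fun_prop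
    simpa using this.tendsto 0
  · obtain ⟨r, a, hr, rfl⟩ := exists_polar hp
    -- Near `polar r a` the function `b` is a continuous branch of the polar angle: rotating by `-a`
    -- moves the point to the positive real axis, away from the cut of `arg`.
    set b : Plane → ℝ := fun q =>
      a + (planeToComplex q * Complex.exp (-(a * Complex.I))).arg with hb
    have hq : ∀ q, q = polar ‖planeToComplex q‖ (b q) := by
      intro q
      apply planeToComplex_injective
      rw [planeToComplex_polar, hb]
      push_cast
      rw [add_mul, Complex.exp_add, mul_left_comm]
      have h1 := Complex.norm_mul_exp_arg_mul_I
        (planeToComplex q * Complex.exp (-(a * Complex.I)))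
      have h2 : ‖Complex.exp (-((a : ℂ) * Complex.I))‖ = 1 := by
        rw [← neg_mul, ← Complex.ofReal_neg, Complex.norm_exp_ofReal_mul_I]
      rw [norm_mul, h2, mul_one] at h1
      rw [h1, mul_left_comm, ← Complex.exp_add]
      simp
    have hbc : ContinuousAt b (polar r a) := by
      have hslit : planeToComplex (polar r a) * Complex.exp (-(a * Complex.I)) ∈
          Complex.slitPlane := by
        rw [planeToComplex_polar, mul_assoc, ← Complex.exp_add]
        simpa using hr
      have h1 : ContinuousAt (fun q => planeToComplex q * Complex.exp (-(a * Complex.I)))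
          (polar r a) := (continuous_planeToComplex.mul continuous_const).continuousAt
      exact continuousAt_const.add
        (ContinuousAt.comp (f := fun q => planeToComplex q * Complex.exp (-(a * Complex.I)))
          (Complex.continuousAt_arg hslit) h1)
    have heq : (fun q => polar (‖planeToComplex q‖ * k (b q)) (h (b q))) =ᶠ[𝓝 (polar r a)]
        polarMap k h := by
      filter_upwards [isOpen_compl_singleton.mem_nhds hp] with q hq0
      conv_rhs => rw [hq q]
      rw [polarMap_polar hk hh (norm_pos_iff.2 (planeToComplex_eq_zero.not.2 hq0)) hkp]
    refine ContinuousAt.congr ?_ heq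
    have h3 : ContinuousAt (fun q => (‖planeToComplex q‖ * k (b q), h (b q))) (polar r a) :=
      (continuous_planeToComplex.norm.continuousAt.mul
        (ContinuousAt.comp hkc.continuousAt hbc)).prodMk
          (ContinuousAt.comp hhc.continuousAt hbc)
    exact ContinuousAt.comp (f := fun q => (‖planeToComplex q‖ * k (b q), h (b q)))
      continuous_polar.continuousAt h3

/-- A homeomorphism of the plane which is homogeneous of degree one. -/
noncomputable def polarHomeomorph (k : ℝ → ℝ) (h : ℝ ≃o ℝ)
    (hk : ∀ a, k (a + 2 * Real.pi) = k a)
    (hh : ∀ a, h (a + 2 * Real.pi) = h a + 2 * Real.pi) (hkp : ∀ a, 0 < k a)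
    (hkc : Continuous k) : Plane ≃ₜ Plane :=
  have hh' : ∀ a, h.symm (a + 2 * Real.pi) = h.symm a + 2 * Real.pi := fun a => by
    rw [h.symm_apply_eq, hh, h.apply_symm_apply]
  have hk' : ∀ a, (k (h.symm (a + 2 * Real.pi)))⁻¹ = (k (h.symm a))⁻¹ := fun a => by
    rw [hh', hk]
  have hkp' : ∀ a, 0 < (k (h.symm a))⁻¹ := fun a => inv_pos.2 (hkp _)
  { toFun := polarMap k h
    invFun := polarMap (fun a => (k (h.symm a))⁻¹) h.symm
    left_inv := by
      intro p
      by_cases hp : p = 0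
      · rw [hp, polarMap_zero, polarMap_zero]
      · obtain ⟨r, a, hr, rfl⟩ := exists_polar hp
        rw [polarMap_polar hk hh hr hkp, polarMap_polar hk' hh' (mul_pos hr (hkp a)) hkp',
          h.symm_apply_apply, mul_assoc, mul_inv_cancel₀ (hkp a).ne', mul_one]
    right_inv := by
      intro p
      by_cases hp : p = 0
      · rw [hp, polarMap_zero, polarMap_zero]
      · obtain ⟨r, a, hr, rfl⟩ := exists_polar hp
        rw [polarMap_polar hk' hh' hr hkp', polarMap_polar hk hh (mul_pos hr (hkp' a)) hkp,
          h.apply_symm_apply, mul_assoc, inv_mul_cancel₀ (hkp _).ne', mul_one]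
    continuous_toFun := continuous_polarMap hk hh hkp hkc h.continuous
    continuous_invFun := continuous_polarMap hk' hh' hkp'
      ((hkc.comp h.symm.continuous).inv₀ fun a => (hkp _).ne') h.symm.continuous }

theorem polarHomeomorph_apply (k : ℝ → ℝ) (h : ℝ ≃o ℝ)
    (hk : ∀ a, k (a + 2 * Real.pi) = k a)
    (hh : ∀ a, h (a + 2 * Real.pi) = h a + 2 * Real.pi) (hkp : ∀ a, 0 < k a)
    (hkc : Continuous k) (p : Plane) : polarHomeomorph k h hk hh hkp hkc p = polarMap k h p :=
  rfl

/-! ### Phases and their nodes. -/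

theorem HasDerivAt.eventually_lt_right {f : ℝ → ℝ} {f' a : ℝ} (hf : HasDerivAt f f' a)
    (h : 0 < f') : ∀ᶠ x in 𝓝[>] a, f a < f x := by
  have h1 := (hasDerivAt_iff_tendsto_slope.1 hf).mono_left
    (nhdsWithin_mono a fun x (hx : a < x) => hx.ne')
  filter_upwards [h1.eventually_const_lt h, self_mem_nhdsWithin] with x hx hax
  rw [slope_def_field, lt_div_iff₀ (sub_pos.2 hax)] at hx
  linarith

theorem HasDerivAt.eventually_lt_left {f : ℝ → ℝ} {f' a : ℝ} (hf : HasDerivAt f f' a)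
    (h : 0 < f') : ∀ᶠ x in 𝓝[<] a, f x < f a := by
  have h1 := (hasDerivAt_iff_tendsto_slope.1 hf).mono_left
    (nhdsWithin_mono a fun x (hx : x < a) => hx.ne)
  filter_upwards [h1.eventually_const_lt h, self_mem_nhdsWithin] with x hx hax
  rw [slope_def_field, lt_div_iff_of_neg (sub_neg.2 hax)] at hx
  linarith

/-- A continuous angle which crosses the multiples of `π` only upwards, and which grows by `N * π`
in a full turn of its argument. -/
structure IsPhase (Ψ : ℝ → ℝ) (N : ℤ) : Prop where
  continuous : Continuous Ψ
  add_two_pi : ∀ a, Ψ (a + 2 * Real.pi) = Ψ a + N * Real.pi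
  hasDerivAt : ∀ a, Real.sin (Ψ a) = 0 → ∃ κ > 0, HasDerivAt Ψ κ a

namespace IsPhase

variable {Ψ : ℝ → ℝ} {N : ℤ}

/-- The set where `Ψ ≥ i π` is closed, and from each of its points it extends to the right: by
continuity above the level, and by the positive derivative on the level. -/
theorem le_of_eq (h : IsPhase Ψ N) {a b : ℝ} {i : ℤ} (ha : Ψ a = i * Real.pi) (hab : a ≤ b) :
    i * Real.pi ≤ Ψ b := by
  have hcl : IsClosed ({x | i * Real.pi ≤ Ψ x} ∩ Set.Icc a b) :=
    (isClosed_le continuous_const h.continuous).inter isClosed_Icc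
  refine hcl.Icc_subset_of_forall_exists_gt ha.ge ?_ (Set.right_mem_Icc.2 hab)
  rintro x ⟨hx, -⟩ y hxy
  have hev : ∀ᶠ z in 𝓝[>] x, i * Real.pi ≤ Ψ z := by
    rcases (show i * Real.pi ≤ Ψ x from hx).eq_or_lt with heq | hlt
    · obtain ⟨κ, hκ, hd⟩ := h.hasDerivAt x (by rw [← heq, Real.sin_int_mul_pi])
      filter_upwards [hd.eventually_lt_right hκ] with z hz
      rw [heq]; exact hz.le
    · filter_upwards [nhdsWithin_le_nhds (h.continuous.continuousAt.eventually_const_lt hlt)]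
        with z hz using hz.le
  obtain ⟨z, hz⟩ := (hev.and (Ioc_mem_nhdsGT hxy)).exists
  exact ⟨z, hz⟩

theorem lt_of_eq (h : IsPhase Ψ N) {a b : ℝ} {i : ℤ} (ha : Ψ a = i * Real.pi) (hab : a < b) :
    i * Real.pi < Ψ b := by
  refine lt_of_le_of_ne (h.le_of_eq ha hab.le) fun heq => ?_
  obtain ⟨κ, hκ, hd⟩ := h.hasDerivAt b (by rw [← heq, Real.sin_int_mul_pi])
  obtain ⟨z, hz1, hz2⟩ := ((hd.eventually_lt_left hκ).and (Ioo_mem_nhdsLT hab)).exists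
  have := h.le_of_eq ha hz2.1.le
  linarith

/-- One turn after a crossing the phase is strictly above the level it crossed, and it has gained
exactly `N π`. -/
theorem pos_of_eq (h : IsPhase Ψ N) {a : ℝ} {i : ℤ} (ha : Ψ a = i * Real.pi) : 0 < N := by
  have h1 := h.lt_of_eq ha (b := a + 2 * Real.pi) (by linarith [Real.pi_pos])
  rw [h.add_two_pi, ha] at h1
  have h2 : 0 < (N : ℝ) * Real.pi := by linarith
  exact_mod_cast (pos_iff_pos_of_mul_pos h2).2 Real.pi_pos

theorem surjective (h : IsPhase Ψ N) (hN : 0 < N) : Function.Surjective Ψ := by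
  intro y
  have hN' : 0 < (N : ℝ) * Real.pi := mul_pos (by exact_mod_cast hN) Real.pi_pos
  obtain ⟨n, hn⟩ := exists_int_gt ((y - Ψ 0) / (N * Real.pi))
  obtain ⟨k, hk⟩ := exists_int_lt ((y - Ψ 0) / (N * Real.pi))
  rw [div_lt_iff₀ hN'] at hn
  rw [lt_div_iff₀ hN'] at hk
  have h1 := map_add_int_mul h.add_two_pi 0 n
  have h2 := map_add_int_mul h.add_two_pi 0 k
  exact mem_range_of_exists_le_of_exists_ge h.continuous ⟨_, by rw [h2]; linarith⟩
    ⟨_, by rw [h1]; linarith⟩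

/-- The argument at which a phase equals `i * π`. -/
noncomputable def node (h : IsPhase Ψ N) (hN : 0 < N) (i : ℤ) : ℝ :=
  (h.surjective hN (i * Real.pi)).choose

variable (h : IsPhase Ψ N) (hN : 0 < N)
include h hN

theorem apply_node (i : ℤ) : Ψ (h.node hN i) = i * Real.pi :=
  (h.surjective hN (i * Real.pi)).choose_spec

theorem node_le_iff {i : ℤ} {a : ℝ} : h.node hN i ≤ a ↔ i * Real.pi ≤ Ψ a := by
  refine ⟨fun ha => h.le_of_eq (h.apply_node hN i) ha, fun ha => ?_⟩
  by_contra! hlt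
  rcases ha.eq_or_lt with heq | hgt
  · have := h.lt_of_eq heq.symm hlt
    rw [h.apply_node hN] at this
    exact this.false
  -- Going back `n` turns brings the phase below `i π`, so there is a crossing of this level left of
  -- `a`, hence left of the node. After it the phase stays strictly above `i π`, which contradicts
  -- its value at the node.
  · obtain ⟨n, hn⟩ := exists_int_gt ((Ψ a - i * Real.pi) / (N * Real.pi))
    have hN' : 0 < (N : ℝ) * Real.pi := mul_pos (by exact_mod_cast hN) Real.pi_pos
    have hn0 : (0 : ℝ) < n := lt_trans (div_pos (by linarith) hN') hn
    rw [div_lt_iff₀ hN'] at hn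
    have hle : a + (-n : ℤ) * (2 * Real.pi) ≤ a := by
      push_cast
      have := mul_pos hn0 Real.pi_pos
      linarith
    obtain ⟨b, hb, hbi⟩ := intermediate_value_Icc hle h.continuous.continuousOn
      (show i * Real.pi ∈ Set.Icc _ _ from ⟨by
        rw [map_add_int_mul h.add_two_pi a (-n)]
        push_cast
        linarith, ha⟩)
    have h3 := h.lt_of_eq hbi (lt_of_le_of_lt hb.2 hlt)
    rw [h.apply_node hN] at h3
    exact h3.false

theorem lt_node_iff {i : ℤ} {a : ℝ} : a < h.node hN i ↔ Ψ a < i * Real.pi := by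
  rw [← not_le, h.node_le_iff hN, not_le]

theorem node_lt_node {i j : ℤ} (hij : i < j) : h.node hN i < h.node hN j := by
  rw [h.lt_node_iff hN, h.apply_node hN]
  exact mul_lt_mul_of_pos_right (by exact_mod_cast hij) Real.pi_pos

theorem eq_node {i : ℤ} {a : ℝ} (ha : Ψ a = i * Real.pi) : a = h.node hN i := by
  refine le_antisymm ?_ ((h.node_le_iff hN).2 ha.ge)
  by_contra! hlt
  have := h.lt_of_eq (h.apply_node hN i) hlt
  linarith

theorem node_add (i : ℤ) : h.node hN (i + N) = h.node hN i + 2 * Real.pi := by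
  refine (h.eq_node hN ?_).symm
  rw [h.add_two_pi, h.apply_node hN]
  push_cast
  ring

theorem node_lt_iff {i : ℤ} {a : ℝ} : h.node hN i < a ↔ i * Real.pi < Ψ a := by
  refine ⟨h.lt_of_eq (h.apply_node hN i), fun ha => ?_⟩
  refine lt_of_le_of_ne ((h.node_le_iff hN).2 ha.le) fun heq => ?_
  rw [← heq, h.apply_node hN] at ha
  exact ha.false

theorem floor_eq_iff {i : ℤ} {a : ℝ} :
    ⌊Ψ a / Real.pi⌋ = i ↔ a ∈ Set.Ico (h.node hN i) (h.node hN (i + 1)) := by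
  rw [Int.floor_eq_iff, le_div_iff₀ Real.pi_pos, div_lt_iff₀ Real.pi_pos, Set.mem_Ico,
    h.node_le_iff hN, h.lt_node_iff hN]
  push_cast
  rfl

theorem sin_ne_zero {i : ℤ} {a : ℝ} (ha : a ∈ Set.Ioo (h.node hN i) (h.node hN (i + 1))) :
    Real.sin (Ψ a) ≠ 0 := by
  intro h0
  obtain ⟨n, hn⟩ := Real.sin_eq_zero_iff.1 h0
  have h1 := (h.node_lt_iff hN).1 ha.1
  have h2 := (h.lt_node_iff hN).1 ha.2
  rw [← hn] at h1 h2
  have h3 := lt_of_mul_lt_mul_right h1 Real.pi_pos.le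
  have h4 := lt_of_mul_lt_mul_right h2 Real.pi_pos.le
  norm_cast at h3 h4
  omega

theorem mem_Ioo {a : ℝ} (ha : Real.sin (Ψ a) ≠ 0) :
    a ∈ Set.Ioo (h.node hN ⌊Ψ a / Real.pi⌋) (h.node hN (⌊Ψ a / Real.pi⌋ + 1)) := by
  have h1 := (h.floor_eq_iff hN (a := a)).1 rfl
  refine ⟨lt_of_le_of_ne h1.1 fun heq => ha ?_, h1.2⟩
  rw [← heq, h.apply_node hN, Real.sin_int_mul_pi]

theorem locallyFinite_Icc :
    LocallyFinite fun i : ℤ => Set.Icc (h.node hN i) (h.node hN (i + 1)) := by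
  intro x
  set i := ⌊Ψ x / Real.pi⌋ with hi
  have hx := (h.floor_eq_iff hN).1 hi.symm
  refine ⟨Set.Ioo (h.node hN (i - 1)) (h.node hN (i + 1)),
    Ioo_mem_nhds (lt_of_lt_of_le (h.node_lt_node hN (by omega)) hx.1) hx.2,
    (Set.finite_Icc (i - 2) (i + 1)).subset ?_⟩
  rintro j ⟨y, ⟨hy1, hy2⟩, hy3, hy4⟩
  have hmono : StrictMono (h.node hN) := fun _ _ => h.node_lt_node hN
  have h1 := hmono.lt_iff_lt.1 (lt_of_le_of_lt hy1 hy4)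
  have h2 := hmono.lt_iff_lt.1 (lt_of_lt_of_le hy3 hy2)
  exact ⟨by omega, by omega⟩

theorem iUnion_Icc : ⋃ i : ℤ, Set.Icc (h.node hN i) (h.node hN (i + 1)) = Set.univ :=
  Set.eq_univ_of_forall fun x => Set.mem_iUnion.2
    ⟨⌊Ψ x / Real.pi⌋, Set.Ico_subset_Icc_self ((h.floor_eq_iff hN).1 rfl)⟩

end IsPhase

/-! ### Asymptotics of the first integral and of the shear at a node. -/

theorem continuousOn_Icc_of_tendsto {f : ℝ → ℝ} {a b : ℝ} (hab : a < b)
    (hf : ContinuousOn f (Set.Ioo a b)) (ha : Filter.Tendsto f (𝓝[>] a) (𝓝 (f a)))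
    (hb : Filter.Tendsto f (𝓝[<] b) (𝓝 (f b))) : ContinuousOn f (Set.Icc a b) := by
  intro x hx
  rcases hx.1.eq_or_lt with rfl | h1
  · exact (continuousWithinAt_Ioi_iff_Ici.1 ha).mono Set.Icc_subset_Ici_self
  rcases hx.2.eq_or_lt with rfl | h2
  · exact (continuousWithinAt_Iio_iff_Iic.1 hb).mono Set.Icc_subset_Iic_self
  · exact (hf.continuousAt (Ioo_mem_nhds h1 h2)).continuousWithinAt

theorem hasDerivAt_integral_of_continuousOn {E : Type*} [NormedAddCommGroup E] [NormedSpace ℝ E]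
    [CompleteSpace E] {f : ℝ → E} {s : Set ℝ} {c x : ℝ} (hs : IsOpen s) (hs' : s.OrdConnected)
    (hf : ContinuousOn f s) (hc : c ∈ s) (hx : x ∈ s) :
    HasDerivAt (fun u => ∫ t in c..u, f t) (f x) x :=
  intervalIntegral.integral_hasDerivAt_right
    (hf.mono (hs'.uIcc_subset hc hx)).intervalIntegrable
    (hf.stronglyMeasurableAtFilter hs x hx) (hf.continuousAt (hs.mem_nhds hx))

/-- The bound on `g` makes `log w - κ log (x - a)` increasing near `a`, so `w` is at most a constant
times `(x - a) ^ κ`. Since `g ≥ 0` there, `(1 / w)' = -|g| / w`, so `τ + 1 / w - x` is constant.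
Hence `τ` equals `-1 / w` up to a bounded term, which gives the other two limits. -/
theorem tendsto_zero_of_logDeriv_ge {w τ g : ℝ → ℝ} {a c κ : ℝ} (hac : a < c) (hκ : 0 < κ)
    (hw : ∀ x ∈ Set.Ioo a c, HasDerivAt w (w x * g x) x) (hwp : ∀ x ∈ Set.Ioo a c, 0 < w x)
    (hτ : ∀ x ∈ Set.Ioo a c, HasDerivAt τ (|g x| / w x + 1) x)
    (hg : ∀ᶠ x in 𝓝[>] a, κ / (x - a) ≤ g x) :
    Filter.Tendsto w (𝓝[>] a) (𝓝 0) ∧ Filter.Tendsto τ (𝓝[>] a) Filter.atBot ∧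
      Filter.Tendsto (fun x => w x * τ x) (𝓝[>] a) (𝓝 (-1)) := by
  obtain ⟨b, hab, hb⟩ := (mem_nhdsGT_iff_exists_Ioo_subset' hac).1
    (Filter.inter_mem hg (Ioo_mem_nhdsGT hac))
  have hab : a < b := hab
  have hbc : ∀ x ∈ Set.Ioo a b, x ∈ Set.Ioo a c := fun x hx => (hb hx).2
  have hbg : ∀ x ∈ Set.Ioo a b, κ / (x - a) ≤ g x := fun x hx => (hb hx).1
  obtain ⟨d, hd⟩ := exists_between hab
  have hev : Set.Ioo a d ∈ 𝓝[>] a := Ioo_mem_nhdsGT hd.1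
  have hsub : ∀ x ∈ Set.Ioo a d, x ∈ Set.Ioo a b := fun x hx => ⟨hx.1, hx.2.trans hd.2⟩
  have hv : ∀ x ∈ Set.Ioo a b,
      HasDerivAt (fun x => Real.log (w x) - κ * Real.log (x - a)) (g x - κ / (x - a)) x := by
    intro x hx
    have h1 := (hw x (hbc x hx)).log (hwp x (hbc x hx)).ne'
    rw [mul_div_cancel_left₀ _ (hwp x (hbc x hx)).ne'] at h1
    have h2 := (((hasDerivAt_id x).sub_const a).log (sub_pos.2 hx.1).ne').const_mul κ
    exact (h1.sub h2).congr_deriv (by simp [div_eq_mul_inv])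
  have hmono : MonotoneOn (fun x => Real.log (w x) - κ * Real.log (x - a)) (Set.Ioo a b) := by
    refine monotoneOn_of_deriv_nonneg (convex_Ioo a b)
      (fun x hx => (hv x hx).continuousAt.continuousWithinAt) ?_ ?_
    · rw [interior_Ioo]
      exact fun x hx => (hv x hx).differentiableAt.differentiableWithinAt
    · rw [interior_Ioo]
      intro x hx
      rw [(hv x hx).deriv]
      exact sub_nonneg.2 (hbg x hx)
  have hlim : Filter.Tendsto (fun x : ℝ => x - a) (𝓝[>] a) (𝓝[>] 0) := by
    refine tendsto_nhdsWithin_iff.2 ⟨?_, ?_⟩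
    · have : Continuous fun x : ℝ => x - a := by fun_prop
      simpa using (this.tendsto a).mono_left nhdsWithin_le_nhds
    · filter_upwards [self_mem_nhdsWithin] with x hx
      exact sub_pos.2 (show a < x from hx)
  have hw0 : Filter.Tendsto w (𝓝[>] a) (𝓝 0) := by
    set K := Real.log (w d) - κ * Real.log (d - a) with hK
    have h1 : Filter.Tendsto (fun x => Real.exp (κ * Real.log (x - a) + K)) (𝓝[>] a) (𝓝 0) := by
      refine Real.tendsto_exp_atBot.comp (Filter.tendsto_atBot_add_const_right _ _ ?_)
      exact (Real.tendsto_log_nhdsGT_zero.comp hlim).const_mul_atBot hκ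
    refine tendsto_of_tendsto_of_tendsto_of_le_of_le' tendsto_const_nhds h1 ?_ ?_
    · filter_upwards [hev] with x hx using (hwp x (hbc x (hsub x hx))).le
    · filter_upwards [hev] with x hx
      have h2 := hmono (hsub x hx) hd hx.2.le
      rw [← Real.log_le_iff_le_exp (hwp x (hbc x (hsub x hx)))]
      simp only at h2
      linarith
  set C := τ d + (w d)⁻¹ - d with hC
  have hτeq : ∀ x ∈ Set.Ioo a d, τ x = C + x - (w x)⁻¹ := by
    have hz : ∀ x ∈ Set.Ioo a b, HasDerivAt (fun x => τ x + (w x)⁻¹ - x) 0 x := by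
      intro x hx
      have hwx := hwp x (hbc x hx)
      have hgx : 0 ≤ g x := (div_nonneg hκ.le (sub_pos.2 hx.1).le).trans (hbg x hx)
      have h1 := ((hτ x (hbc x hx)).add ((hw x (hbc x hx)).inv hwx.ne')).sub (hasDerivAt_id x)
      refine h1.congr_deriv ?_
      rw [abs_of_nonneg hgx]
      field_simp
      ring
    intro x hx
    have h1 := isOpen_Ioo.is_const_of_deriv_eq_zero isPreconnected_Ioo
      (fun y hy => (hz y hy).differentiableAt.differentiableWithinAt)
      (fun y hy => (hz y hy).deriv) (hsub x hx) hd
    linarith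
  have hlin : Filter.Tendsto (fun x : ℝ => C + x) (𝓝[>] a) (𝓝 (C + a)) :=
    ((continuous_const.add continuous_id).tendsto a).mono_left nhdsWithin_le_nhds
  refine ⟨hw0, ?_, ?_⟩
  · have hw0' : Filter.Tendsto w (𝓝[>] a) (𝓝[>] 0) := by
      refine tendsto_nhdsWithin_iff.2 ⟨hw0, ?_⟩
      filter_upwards [hev] with x hx using hwp x (hbc x (hsub x hx))
    have h1 : Filter.Tendsto (fun x => (C + x) + -(w x)⁻¹) (𝓝[>] a) Filter.atBot :=
      hlin.add_atBot (Filter.tendsto_neg_atTop_atBot.comp hw0'.inv_tendsto_nhdsGT_zero)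
    refine h1.congr' ?_
    filter_upwards [hev] with x hx
    rw [hτeq x hx, sub_eq_add_neg]
  · have h1 : Filter.Tendsto (fun x => w x * (C + x) - 1) (𝓝[>] a) (𝓝 (0 * (C + a) - 1)) :=
      (hw0.mul hlin).sub_const 1
    rw [zero_mul, zero_sub] at h1
    refine h1.congr' ?_
    filter_upwards [hev] with x hx
    rw [hτeq x hx, mul_sub, mul_inv_cancel₀ (hwp x (hbc x (hsub x hx))).ne']

/-- This is the previous lemma reflected by `x ↦ -x`, with `τ` and `g` replaced by their opposites.
-/
theorem tendsto_zero_of_logDeriv_le {w τ g : ℝ → ℝ} {b c κ : ℝ} (hcb : c < b) (hκ : 0 < κ)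
    (hw : ∀ x ∈ Set.Ioo c b, HasDerivAt w (w x * g x) x) (hwp : ∀ x ∈ Set.Ioo c b, 0 < w x)
    (hτ : ∀ x ∈ Set.Ioo c b, HasDerivAt τ (|g x| / w x + 1) x)
    (hg : ∀ᶠ x in 𝓝[<] b, g x ≤ κ / (x - b)) :
    Filter.Tendsto w (𝓝[<] b) (𝓝 0) ∧ Filter.Tendsto τ (𝓝[<] b) Filter.atTop ∧
      Filter.Tendsto (fun x => w x * τ x) (𝓝[<] b) (𝓝 1) := by
  have hneg : Filter.Tendsto (fun x : ℝ => -x) (𝓝[<] b) (𝓝[>] (-b)) := by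
    simpa using tendsto_neg_nhdsLT (a := b)
  have hneg' : Filter.Tendsto (fun x : ℝ => -x) (𝓝[>] (-b)) (𝓝[<] b) := by
    simpa using tendsto_neg_nhdsGT (a := -b)
  have hmem : ∀ x ∈ Set.Ioo (-b) (-c), -x ∈ Set.Ioo c b := fun x hx =>
    ⟨by linarith [hx.2], by linarith [hx.1]⟩
  obtain ⟨h1, h2, h3⟩ := tendsto_zero_of_logDeriv_ge (w := fun x => w (-x))
    (τ := fun x => -τ (-x)) (g := fun x => -g (-x)) (a := -b) (c := -c) (κ := κ)
    (by linarith) hκ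
    (fun x hx => ((hw _ (hmem x hx)).scomp x (hasDerivAt_neg x)).congr_deriv (by simp))
    (fun x hx => hwp _ (hmem x hx))
    (fun x hx => ((hτ _ (hmem x hx)).scomp x (hasDerivAt_neg x)).neg.congr_deriv (by simp)) (by
      filter_upwards [hneg'.eventually hg] with x hx
      have h4 : κ / (x - -b) = -(κ / (-x - b)) := by
        rw [← div_neg]
        congr 1
        ring
      rw [h4]
      linarith)
  have h1' := h1.comp hneg
  have h2' := Filter.tendsto_neg_atBot_atTop.comp (h2.comp hneg)
  have h3' := (h3.comp hneg).neg
  refine ⟨?_, ?_, ?_⟩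
  · simpa [Function.comp_def] using h1'
  · simpa [Function.comp_def] using h2'
  · simpa [Function.comp_def] using h3'

/-! ### The amplitude and the shear of a phase. -/

/-- The slope `dr / (r da)` of a line field whose angle with the radial direction is `-Ψ`, up to
sign. -/
noncomputable def phaseCot (Ψ : ℝ → ℝ) (x : ℝ) : ℝ := Real.cos (Ψ x) / Real.sin (Ψ x)

/-- `phaseAmplitude Ψ c x * r` is constant along the curves with angle `-Ψ` to the radial
direction. -/
noncomputable def phaseAmplitude (Ψ : ℝ → ℝ) (c x : ℝ) : ℝ :=
  Real.exp (∫ t in c..x, phaseCot Ψ t)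

/-- A function which grows so fast as to behave as the inverse of `phaseAmplitude`, up to sign,
at the zeros of the latter. -/
noncomputable def phaseShear (Ψ : ℝ → ℝ) (c x : ℝ) : ℝ :=
  ∫ t in c..x, (|phaseCot Ψ t| / phaseAmplitude Ψ c t + 1)

theorem phaseAmplitude_pos (Ψ : ℝ → ℝ) (c x : ℝ) : 0 < phaseAmplitude Ψ c x := Real.exp_pos _

/-- The product tends to `1 / κ`, because `cot Ψ` has a simple pole with this residue. The positive
residue is what drives the amplitude to `0` on both sides of a node. -/
theorem phaseCot_mul_sub {Ψ : ℝ → ℝ} {κ a : ℝ} (hd : HasDerivAt Ψ κ a) (hκ : 0 < κ)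
    (h0 : Real.sin (Ψ a) = 0) : ∀ᶠ x in 𝓝[≠] a, 1 / (2 * κ) < phaseCot Ψ x * (x - a) := by
  have hcos : Real.cos (Ψ a) ≠ 0 := fun hc => by
    have := Real.sin_sq_add_cos_sq (Ψ a)
    rw [h0, hc] at this
    norm_num at this
  have h1 := hasDerivAt_iff_tendsto_slope.1 hd.sin
  have h2 : Filter.Tendsto (fun x => Real.cos (Ψ x)) (𝓝[≠] a) (𝓝 (Real.cos (Ψ a))) :=
    hd.cos.continuousAt.mono_left nhdsWithin_le_nhds
  have h3 := h2.div h1 (mul_ne_zero hcos hκ.ne')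
  have h4 : Real.cos (Ψ a) / (Real.cos (Ψ a) * κ) = 1 / κ := by field_simp
  rw [h4] at h3
  have h5 : 1 / (2 * κ) < 1 / κ := one_div_lt_one_div_of_lt hκ (by linarith)
  filter_upwards [h3.eventually_const_lt h5] with x hx
  refine hx.trans_eq ?_
  simp only [Pi.div_apply, slope_def_field, h0, sub_zero, phaseCot]
  rw [div_div_eq_mul_div, div_mul_eq_mul_div]

namespace IsPhase

variable {Ψ : ℝ → ℝ} {N : ℤ}

theorem phaseCot_add (h : IsPhase Ψ N) (x : ℝ) : phaseCot Ψ (x + 2 * Real.pi) = phaseCot Ψ x := by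
  rw [phaseCot, phaseCot, h.add_two_pi, Real.cos_add_int_mul_pi, Real.sin_add_int_mul_pi,
    mul_div_mul_left _ _ (zpow_ne_zero _ (by norm_num))]

theorem phaseAmplitude_add (h : IsPhase Ψ N) (c x : ℝ) :
    phaseAmplitude Ψ (c + 2 * Real.pi) (x + 2 * Real.pi) = phaseAmplitude Ψ c x := by
  rw [phaseAmplitude, phaseAmplitude, ← intervalIntegral.integral_comp_add_right]
  simp only [h.phaseCot_add]

theorem phaseShear_add (h : IsPhase Ψ N) (c x : ℝ) :
    phaseShear Ψ (c + 2 * Real.pi) (x + 2 * Real.pi) = phaseShear Ψ c x := by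
  rw [phaseShear, phaseShear, ← intervalIntegral.integral_comp_add_right]
  simp only [h.phaseCot_add, h.phaseAmplitude_add]

theorem floor_add (h : IsPhase Ψ N) (x : ℝ) : ⌊Ψ (x + 2 * Real.pi) / Real.pi⌋ = ⌊Ψ x / Real.pi⌋ + N := by
  rw [h.add_two_pi, add_div, mul_div_cancel_right₀ _ Real.pi_pos.ne', Int.floor_add_intCast]

theorem sin_add_eq_zero_iff (h : IsPhase Ψ N) (x : ℝ) :
    Real.sin (Ψ (x + 2 * Real.pi)) = 0 ↔ Real.sin (Ψ x) = 0 := by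
  rw [h.add_two_pi, Real.sin_add_int_mul_pi]
  simp [zpow_ne_zero]

variable (h : IsPhase Ψ N) (hN : 0 < N)

theorem continuousOn_phaseCot (i : ℤ) :
    ContinuousOn (phaseCot Ψ) (Set.Ioo (h.node hN i) (h.node hN (i + 1))) :=
  (Real.continuous_cos.comp h.continuous).continuousOn.div
    (Real.continuous_sin.comp h.continuous).continuousOn fun _ hx => h.sin_ne_zero hN hx

theorem hasDerivAt_phaseAmplitude {i : ℤ} {c x : ℝ}
    (hc : c ∈ Set.Ioo (h.node hN i) (h.node hN (i + 1)))
    (hx : x ∈ Set.Ioo (h.node hN i) (h.node hN (i + 1))) :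
    HasDerivAt (phaseAmplitude Ψ c) (phaseAmplitude Ψ c x * phaseCot Ψ x) x :=
  (hasDerivAt_integral_of_continuousOn isOpen_Ioo Set.ordConnected_Ioo (h.continuousOn_phaseCot hN i) hc hx).exp

theorem hasDerivAt_phaseShear {i : ℤ} {c x : ℝ}
    (hc : c ∈ Set.Ioo (h.node hN i) (h.node hN (i + 1)))
    (hx : x ∈ Set.Ioo (h.node hN i) (h.node hN (i + 1))) :
    HasDerivAt (phaseShear Ψ c) (|phaseCot Ψ x| / phaseAmplitude Ψ c x + 1) x := by
  refine hasDerivAt_integral_of_continuousOn isOpen_Ioo Set.ordConnected_Ioo (ContinuousOn.add (ContinuousOn.div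
    (h.continuousOn_phaseCot hN i).abs ?_ fun y _ => (phaseAmplitude_pos Ψ c y).ne')
    continuousOn_const) hc hx
  exact fun y hy => (h.hasDerivAt_phaseAmplitude hN hc hy).continuousAt.continuousWithinAt

theorem strictMonoOn_phaseShear {i : ℤ} {c : ℝ}
    (hc : c ∈ Set.Ioo (h.node hN i) (h.node hN (i + 1))) :
    StrictMonoOn (phaseShear Ψ c) (Set.Ioo (h.node hN i) (h.node hN (i + 1))) := by
  refine strictMonoOn_of_deriv_pos (convex_Ioo _ _)
    (fun x hx => (h.hasDerivAt_phaseShear hN hc hx).continuousAt.continuousWithinAt) ?_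
  rw [interior_Ioo]
  intro x hx
  rw [(h.hasDerivAt_phaseShear hN hc hx).deriv]
  have := phaseAmplitude_pos Ψ c x
  positivity

theorem tendsto_right {i : ℤ} {c : ℝ} (hc : c ∈ Set.Ioo (h.node hN i) (h.node hN (i + 1))) :
    Filter.Tendsto (phaseAmplitude Ψ c) (𝓝[>] h.node hN i) (𝓝 0) ∧
      Filter.Tendsto (phaseShear Ψ c) (𝓝[>] h.node hN i) Filter.atBot ∧
      Filter.Tendsto (fun x => phaseAmplitude Ψ c x * phaseShear Ψ c x) (𝓝[>] h.node hN i)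
        (𝓝 (-1)) := by
  have h0 : Real.sin (Ψ (h.node hN i)) = 0 := by rw [h.apply_node hN, Real.sin_int_mul_pi]
  obtain ⟨κ, hκ, hd⟩ := h.hasDerivAt _ h0
  refine tendsto_zero_of_logDeriv_ge (h.node_lt_node hN (lt_add_one i))
    (one_div_pos.2 (mul_pos two_pos hκ))
    (fun x hx => h.hasDerivAt_phaseAmplitude hN hc hx) (fun x _ => phaseAmplitude_pos Ψ c x)
    (fun x hx => h.hasDerivAt_phaseShear hN hc hx) ?_
  filter_upwards [(phaseCot_mul_sub hd hκ h0).filter_mono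
    (nhdsWithin_mono _ fun x (hx : _ < x) => hx.ne'), self_mem_nhdsWithin] with x hx hax
  exact (div_le_iff₀ (sub_pos.2 hax)).2 hx.le

theorem tendsto_left {i : ℤ} {c : ℝ} (hc : c ∈ Set.Ioo (h.node hN i) (h.node hN (i + 1))) :
    Filter.Tendsto (phaseAmplitude Ψ c) (𝓝[<] h.node hN (i + 1)) (𝓝 0) ∧
      Filter.Tendsto (phaseShear Ψ c) (𝓝[<] h.node hN (i + 1)) Filter.atTop ∧
      Filter.Tendsto (fun x => phaseAmplitude Ψ c x * phaseShear Ψ c x) (𝓝[<] h.node hN (i + 1))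
        (𝓝 1) := by
  have h0 : Real.sin (Ψ (h.node hN (i + 1))) = 0 := by rw [h.apply_node hN, Real.sin_int_mul_pi]
  obtain ⟨κ, hκ, hd⟩ := h.hasDerivAt _ h0
  refine tendsto_zero_of_logDeriv_le (h.node_lt_node hN (lt_add_one i))
    (one_div_pos.2 (mul_pos two_pos hκ))
    (fun x hx => h.hasDerivAt_phaseAmplitude hN hc hx) (fun x _ => phaseAmplitude_pos Ψ c x)
    (fun x hx => h.hasDerivAt_phaseShear hN hc hx) ?_
  filter_upwards [(phaseCot_mul_sub hd hκ h0).filter_mono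
    (nhdsWithin_mono _ fun x (hx : x < _) => hx.ne), self_mem_nhdsWithin] with x hx hax
  exact (le_div_iff_of_neg (sub_neg.2 hax)).2 hx.le

/-! ### Horizontal coordinates for a phase. -/

/-- The middle of the sector between two consecutive nodes. -/
noncomputable def mid (i : ℤ) : ℝ := (h.node hN i + h.node hN (i + 1)) / 2

theorem mid_mem (i : ℤ) : h.mid hN i ∈ Set.Ioo (h.node hN i) (h.node hN (i + 1)) := by
  have := h.node_lt_node hN (lt_add_one i)
  constructor <;> rw [mid] <;> linarith

theorem mid_add (i : ℤ) : h.mid hN (i + N) = h.mid hN i + 2 * Real.pi := by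
  rw [mid, mid, add_right_comm, h.node_add, h.node_add]
  ring

/-- The angle of the horizontal model of a phase. -/
noncomputable def angle (x : ℝ) : ℝ :=
  ⌊Ψ x / Real.pi⌋ * Real.pi + if Real.sin (Ψ x) = 0 then 0 else
    Real.pi / 2 + Real.arctan (phaseShear Ψ (h.mid hN ⌊Ψ x / Real.pi⌋) x)

/-- The radial scale of the horizontal model of a phase. -/
noncomputable def scale (x : ℝ) : ℝ :=
  if Real.sin (Ψ x) = 0 then 1 else
    phaseAmplitude Ψ (h.mid hN ⌊Ψ x / Real.pi⌋) x *
      √(1 + phaseShear Ψ (h.mid hN ⌊Ψ x / Real.pi⌋) x ^ 2)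

theorem floor_node (i : ℤ) : ⌊Ψ (h.node hN i) / Real.pi⌋ = i := by
  rw [h.apply_node, mul_div_cancel_right₀ _ Real.pi_pos.ne', Int.floor_intCast]

theorem angle_node (i : ℤ) : h.angle hN (h.node hN i) = i * Real.pi := by
  rw [angle, h.floor_node, h.apply_node, if_pos (Real.sin_int_mul_pi i), add_zero]

theorem scale_node (i : ℤ) : h.scale hN (h.node hN i) = 1 := by
  rw [scale, h.apply_node, if_pos (Real.sin_int_mul_pi i)]

theorem angle_of_mem {i : ℤ} {x : ℝ} (hx : x ∈ Set.Ioo (h.node hN i) (h.node hN (i + 1))) :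
    h.angle hN x = i * Real.pi + (Real.pi / 2 + Real.arctan (phaseShear Ψ (h.mid hN i) x)) := by
  rw [angle, (h.floor_eq_iff hN).2 (Set.Ioo_subset_Ico_self hx), if_neg (h.sin_ne_zero hN hx)]

theorem scale_of_mem {i : ℤ} {x : ℝ} (hx : x ∈ Set.Ioo (h.node hN i) (h.node hN (i + 1))) :
    h.scale hN x = phaseAmplitude Ψ (h.mid hN i) x * √(1 + phaseShear Ψ (h.mid hN i) x ^ 2) := by
  rw [scale, (h.floor_eq_iff hN).2 (Set.Ioo_subset_Ico_self hx), if_neg (h.sin_ne_zero hN hx)]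

theorem scale_pos (x : ℝ) : 0 < h.scale hN x := by
  rw [scale]
  split_ifs
  · exact one_pos
  · have := phaseAmplitude_pos Ψ (h.mid hN ⌊Ψ x / Real.pi⌋) x
    positivity

/-- With amplitude `w` and shear `τ`, the model point of a sector is, up to the sign `(-1) ^ i`, the
point `(-r w τ, r w)`; its polar coordinates are `r` times the scale, and the angle. Its height is
thus the first integral `r w`, so leaves become horizontal. -/
theorem scale_mul_sin_angle {i : ℤ} {x : ℝ}
    (hx : x ∈ Set.Ioo (h.node hN i) (h.node hN (i + 1))) :
    h.scale hN x * Real.sin (h.angle hN x) = (-1) ^ i * phaseAmplitude Ψ (h.mid hN i) x := by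
  rw [h.scale_of_mem hN hx, h.angle_of_mem hN hx, add_comm (i * Real.pi), Real.sin_add_int_mul_pi,
    add_comm (Real.pi / 2), Real.sin_add_pi_div_two, Real.cos_arctan]
  have : √(1 + phaseShear Ψ (h.mid hN i) x ^ 2) ≠ 0 := by positivity
  field_simp

theorem floor_angle (x : ℝ) : ⌊h.angle hN x / Real.pi⌋ = ⌊Ψ x / Real.pi⌋ := by
  rw [Int.floor_eq_iff, le_div_iff₀ Real.pi_pos, div_lt_iff₀ Real.pi_pos, angle]
  have := Real.pi_pos
  split_ifs
  · constructor <;> linarith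
  · have h1 := Real.neg_pi_div_two_lt_arctan (phaseShear Ψ (h.mid hN ⌊Ψ x / Real.pi⌋) x)
    have h2 := Real.arctan_lt_pi_div_two (phaseShear Ψ (h.mid hN ⌊Ψ x / Real.pi⌋) x)
    constructor <;> linarith

theorem sin_angle_eq_zero_iff {x : ℝ} : Real.sin (h.angle hN x) = 0 ↔ Real.sin (Ψ x) = 0 := by
  constructor
  · intro h0
    by_contra hne
    have h1 := h.scale_mul_sin_angle hN (h.mem_Ioo hN hne)
    rw [h0, mul_zero] at h1
    exact mul_ne_zero (zpow_ne_zero _ (by norm_num)) (phaseAmplitude_pos _ _ _).ne' h1.symm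
  · intro h0
    rw [angle, if_pos h0, add_zero, Real.sin_int_mul_pi]

theorem strictMono_angle : StrictMono (h.angle hN) := by
  intro x y hxy
  have hxi := (h.floor_eq_iff hN (a := x)).1 rfl
  have hyi := (h.floor_eq_iff hN (a := y)).1 rfl
  have hle : ⌊Ψ x / Real.pi⌋ ≤ ⌊Ψ y / Real.pi⌋ := by
    rw [Int.le_floor, le_div_iff₀ Real.pi_pos, ← h.node_le_iff hN]
    exact hxi.1.trans hxy.le
  rcases hle.eq_or_lt with heq | hlt
  · have hy : y ∈ Set.Ioo (h.node hN ⌊Ψ x / Real.pi⌋) (h.node hN (⌊Ψ x / Real.pi⌋ + 1)) := by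
      rw [← heq] at hyi
      exact ⟨hxi.1.trans_lt hxy, hyi.2⟩
    rw [h.angle_of_mem hN hy]
    by_cases hx : Real.sin (Ψ x) = 0
    · have := Real.neg_pi_div_two_lt_arctan (phaseShear Ψ (h.mid hN ⌊Ψ x / Real.pi⌋) y)
      rw [angle, if_pos hx]
      linarith
    · rw [h.angle_of_mem hN (h.mem_Ioo hN hx)]
      have := Real.arctan_strictMono
        (h.strictMonoOn_phaseShear hN (h.mid_mem hN _) (h.mem_Ioo hN hx) hy hxy)
      linarith
  · have h1 := h.floor_angle hN x
    have h2 := h.floor_angle hN y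
    rw [← h1, ← h2] at hlt
    exact (div_lt_div_iff_of_pos_right Real.pi_pos).1 (Int.floor_mono.reflect_lt hlt)

/-- The shear runs from `-∞` to `+∞` across a sector, so the arctangent supplies exactly the values
`i π` and `(i + 1) π` at its two ends. -/
theorem continuous_angle : Continuous (h.angle hN) := by
  refine (h.locallyFinite_Icc hN).continuous (h.iUnion_Icc hN) (fun i => isClosed_Icc) fun i => ?_
  have hlt := h.node_lt_node hN (lt_add_one i)
  have hev : ∀ x ∈ Set.Ioo (h.node hN i) (h.node hN (i + 1)),
      i * Real.pi + (Real.pi / 2 + Real.arctan (phaseShear Ψ (h.mid hN i) x)) = h.angle hN x :=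
    fun x hx => (h.angle_of_mem hN hx).symm
  refine continuousOn_Icc_of_tendsto hlt ?_ ?_ ?_
  · refine ContinuousOn.congr ?_ fun x hx => (hev x hx).symm
    exact fun x hx => (continuousAt_const.add (continuousAt_const.add
      (ContinuousAt.comp Real.continuous_arctan.continuousAt
        (h.hasDerivAt_phaseShear hN (h.mid_mem hN i) hx).continuousAt))).continuousWithinAt
  · rw [h.angle_node]
    have h1 := (((Real.tendsto_arctan_atBot.mono_right nhdsWithin_le_nhds).comp
      (h.tendsto_right hN (h.mid_mem hN i)).2.1).const_add (Real.pi / 2)).const_add (i * Real.pi)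
    rw [add_neg_cancel, add_zero] at h1
    exact h1.congr' (Filter.eventually_of_mem (Ioo_mem_nhdsGT hlt) hev)
  · rw [h.angle_node]
    have h1 := (((Real.tendsto_arctan_atTop.mono_right nhdsWithin_le_nhds).comp
      (h.tendsto_left hN (h.mid_mem hN i)).2.1).const_add (Real.pi / 2)).const_add (i * Real.pi)
    have h2 : (i : ℝ) * Real.pi + (Real.pi / 2 + Real.pi / 2) = (i + 1 : ℤ) * Real.pi := by
      push_cast
      ring
    rw [h2] at h1
    exact h1.congr' (Filter.eventually_of_mem (Ioo_mem_nhdsLT hlt) hev)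

theorem continuous_scale : Continuous (h.scale hN) := by
  refine (h.locallyFinite_Icc hN).continuous (h.iUnion_Icc hN) (fun i => isClosed_Icc) fun i => ?_
  have hlt := h.node_lt_node hN (lt_add_one i)
  have hev : ∀ x ∈ Set.Ioo (h.node hN i) (h.node hN (i + 1)),
      √(phaseAmplitude Ψ (h.mid hN i) x ^ 2 +
        (phaseAmplitude Ψ (h.mid hN i) x * phaseShear Ψ (h.mid hN i) x) ^ 2) = h.scale hN x := by
    -- Written as the square root of `w ^ 2 + (w τ) ^ 2`, the scale visibly tends to `1` at the
    -- nodes, where `w` tends to `0` and `w τ` to `-1` or `1`. This is why the shear was made to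
    -- grow like `1 / w`.
    intro x hx
    have hp := phaseAmplitude_pos Ψ (h.mid hN i) x
    rw [h.scale_of_mem hN hx, mul_pow, ← mul_one_add, Real.sqrt_mul (sq_nonneg _),
      Real.sqrt_sq hp.le]
  have hlim : ∀ {l : Filter ℝ} {s : ℝ}, s ^ 2 = 1 →
      Filter.Tendsto (phaseAmplitude Ψ (h.mid hN i)) l (𝓝 0) →
      Filter.Tendsto (fun x => phaseAmplitude Ψ (h.mid hN i) x * phaseShear Ψ (h.mid hN i) x) l
        (𝓝 s) → Filter.Tendsto (fun x => √(phaseAmplitude Ψ (h.mid hN i) x ^ 2 +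
        (phaseAmplitude Ψ (h.mid hN i) x * phaseShear Ψ (h.mid hN i) x) ^ 2)) l (𝓝 1) := by
    intro l s hs h1 h2
    have := ((h1.pow 2).add (h2.pow 2)).sqrt
    rw [hs] at this
    simpa using this
  refine continuousOn_Icc_of_tendsto hlt ?_ ?_ ?_
  · refine ContinuousOn.congr ?_ fun x hx => (hev x hx).symm
    intro x hx
    have h1 := (h.hasDerivAt_phaseShear hN (h.mid_mem hN i) hx).continuousAt
    have h2 := (h.hasDerivAt_phaseAmplitude hN (h.mid_mem hN i) hx).continuousAt
    exact (((h2.pow 2).add ((h2.mul h1).pow 2)).sqrt).continuousWithinAt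
  · rw [h.scale_node]
    have h1 := h.tendsto_right hN (h.mid_mem hN i)
    exact (hlim (by norm_num) h1.1 h1.2.2).congr'
      (Filter.eventually_of_mem (Ioo_mem_nhdsGT hlt) hev)
  · rw [h.scale_node]
    have h1 := h.tendsto_left hN (h.mid_mem hN i)
    exact (hlim (by norm_num) h1.1 h1.2.2).congr'
      (Filter.eventually_of_mem (Ioo_mem_nhdsLT hlt) hev)

theorem angle_add (x : ℝ) : h.angle hN (x + 2 * Real.pi) = h.angle hN x + N * Real.pi := by
  simp only [angle, h.floor_add, h.sin_add_eq_zero_iff, h.mid_add, h.phaseShear_add]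
  push_cast
  ring

theorem scale_add (x : ℝ) : h.scale hN (x + 2 * Real.pi) = h.scale hN x := by
  simp only [scale, h.floor_add, h.sin_add_eq_zero_iff, h.mid_add, h.phaseShear_add,
    h.phaseAmplitude_add]

theorem surjective_angle : Function.Surjective (h.angle hN) := by
  intro y
  refine mem_range_of_exists_le_of_exists_ge (h.continuous_angle hN)
    ⟨h.node hN ⌊y / Real.pi⌋, ?_⟩ ⟨h.node hN (⌊y / Real.pi⌋ + 1), ?_⟩
  · rw [h.angle_node, ← le_div_iff₀ Real.pi_pos]
    exact Int.floor_le _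
  · rw [h.angle_node, ← div_le_iff₀ Real.pi_pos]
    push_cast
    exact (Int.lt_floor_add_one _).le

end IsPhase

/-! ### The horizontal model and the conjugacy of two fields. -/

/-- The line field `L` is, in suitable homogeneous coordinates on the angular covering of the
punctured plane, the foliation by horizontal lines; `T` is the new angle and `ρ` the new radial
scale, and a turn around the origin adds `N * π` to the new angle. -/
structure IsHorizontalModel (L : Plane → Submodule ℝ Plane) (N : ℤ) (T ρ : ℝ → ℝ) : Prop where
  continuous_angle : Continuous T
  strictMono : StrictMono T
  surjective : Function.Surjective T
  angle_add : ∀ a, T (a + 2 * Real.pi) = T a + N * Real.pi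
  continuous_scale : Continuous ρ
  scale_pos : ∀ a, 0 < ρ a
  scale_add : ∀ a, ρ (a + 2 * Real.pi) = ρ a
  leaf_eq : ∀ r a : ℝ, 0 < r → leaf L (polar r a) =
    {q | ∃ r' a' : ℝ, 0 < r' ∧ q = polar r' a' ∧ ⌊T a / Real.pi⌋ = ⌊T a' / Real.pi⌋ ∧
      r * ρ a * Real.sin (T a) = r' * ρ a' * Real.sin (T a') ∧
      (Real.sin (T a) = 0 → T a = T a')}

/-- The homeomorphism identifies points with the same model coordinates: the angle goes to `S⁻¹ (T
a)` and the radius is multiplied by `ρ a / σ (h a)`. It descends from the angular covering to the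
plane because both model angles gain the same `N π` in a turn. -/
theorem IsHorizontalModel.topEquivalent {L M : Plane → Submodule ℝ Plane} {N : ℤ}
    {T ρ S σ : ℝ → ℝ} (hL : IsHorizontalModel L N T ρ) (hM : IsHorizontalModel M N S σ) :
    TopEquivalent L M := by
  let eT := hL.strictMono.orderIsoOfSurjective T hL.surjective
  let eS := hM.strictMono.orderIsoOfSurjective S hM.surjective
  let h : ℝ ≃o ℝ := eT.trans eS.symm
  have hS : ∀ a, S (h a) = T a := fun a => eS.apply_symm_apply (T a)
  have hh : ∀ a, h (a + 2 * Real.pi) = h a + 2 * Real.pi := fun a =>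
    hM.strictMono.injective (by rw [hS, hL.angle_add, hM.angle_add, hS])
  have hk : ∀ a, ρ (a + 2 * Real.pi) / σ (h (a + 2 * Real.pi)) = ρ a / σ (h a) := fun a => by
    rw [hh, hL.scale_add, hM.scale_add]
  have hkp : ∀ a, 0 < ρ a / σ (h a) := fun a => div_pos (hL.scale_pos _) (hM.scale_pos _)
  have hkc : Continuous fun a => ρ a / σ (h a) :=
    hL.continuous_scale.div (hM.continuous_scale.comp h.continuous) fun a => (hM.scale_pos _).ne'
  have hscale : ∀ r a, r * (ρ a / σ (h a)) * σ (h a) = r * ρ a := fun r a => by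
    have := (hM.scale_pos (h a)).ne'
    field_simp
  refine ⟨polarHomeomorph (fun a => ρ a / σ (h a)) h hk hh hkp hkc,
    polarMap_zero (fun a => ρ a / σ (h a)) h, fun p hp => ?_⟩
  obtain ⟨r, a, hr, rfl⟩ := exists_polar hp
  rw [polarHomeomorph_apply, polarMap_polar hk hh hr hkp, hL.leaf_eq r a hr,
    hM.leaf_eq _ _ (mul_pos hr (hkp a))]
  ext q
  simp only [Set.mem_image, Set.mem_ofPred_eq, hS, hscale]
  constructor
  · rintro ⟨_, ⟨r', a', hr', rfl, h1, h2, h3⟩, rfl⟩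
    refine ⟨r' * (ρ a' / σ (h a')), h a', mul_pos hr' (hkp a'), ?_, ?_, ?_, ?_⟩
    · rw [polarHomeomorph_apply, polarMap_polar hk hh hr' hkp]
    · rwa [hS]
    · rwa [hS, hscale]
    · rwa [hS]
  · rintro ⟨r', b, hr', rfl, h1, h2, h3⟩
    obtain ⟨a', rfl⟩ := h.surjective b
    rw [hS] at h1 h2 h3
    have hp' := div_pos hr' (hkp a')
    have h4 : r' / (ρ a' / σ (h a')) * (ρ a' / σ (h a')) = r' :=
      div_mul_cancel₀ _ (hkp a').ne'
    refine ⟨polar (r' / (ρ a' / σ (h a'))) a', ⟨_, a', hp', rfl, h1, ?_, h3⟩, ?_⟩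
    · rw [h2, ← hscale, h4]
    · rw [polarHomeomorph_apply, polarMap_polar hk hh hp' hkp, h4]

/-! ### Integral curves in polar coordinates, leaves and index. -/

theorem mem_span_polar_iff {v : Plane} {b : ℝ} :
    v ∈ Submodule.span ℝ {polar 1 b} ↔ v 0 * Real.sin b = v 1 * Real.cos b := by
  rw [Submodule.mem_span_singleton]
  constructor
  · rintro ⟨c, rfl⟩
    simp [polar]
    ring
  · intro h
    refine ⟨v 0 * Real.cos b + v 1 * Real.sin b, ?_⟩
    have h1 := Real.sin_sq_add_cos_sq b
    ext i
    fin_cases i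
    · simp only [polar, one_mul, Fin.zero_eta, Pi.smul_apply, Matrix.cons_val_zero, smul_eq_mul]
      linear_combination (-Real.sin b) * h + v 0 * h1
    · simp only [polar, one_mul, Fin.mk_one, Pi.smul_apply, Matrix.cons_val_one, smul_eq_mul,
        Matrix.cons_val_fin_one]
      linear_combination (Real.cos b) * h + v 1 * h1

theorem hasDerivAt_polar {ρ α : ℝ → ℝ} {ρ' α' t : ℝ} (hρ : HasDerivAt ρ ρ' t)
    (hα : HasDerivAt α α' t) : HasDerivAt (fun s => polar (ρ s) (α s))
      ![ρ' * Real.cos (α t) - ρ t * α' * Real.sin (α t),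
        ρ' * Real.sin (α t) + ρ t * α' * Real.cos (α t)] t := by
  refine hasDerivAt_pi.2 fun i => ?_
  fin_cases i
  · exact (hρ.mul hα.cos).congr_deriv (by simp; ring)
  · exact (hρ.mul hα.sin).congr_deriv (by simp; ring)

/-- In the polar frame the tangent vector is `(ρ', ρ α')` and the line has direction `(cos ψ, -sin
ψ)`; the equation is the vanishing of their determinant. -/
theorem polar_tangent_mem_span_iff {ρ ρ' α α' ψ : ℝ} :
    ![ρ' * Real.cos α - ρ * α' * Real.sin α, ρ' * Real.sin α + ρ * α' * Real.cos α] ∈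
      Submodule.span ℝ {polar 1 (α - ψ)} ↔ ρ' * Real.sin ψ + ρ * α' * Real.cos ψ = 0 := by
  rw [mem_span_polar_iff, ← sub_eq_zero, ← neg_eq_zero (a := ρ' * Real.sin ψ + _), Real.sin_sub,
    Real.cos_sub]
  have h1 := Real.sin_sq_add_cos_sq α
  simp only [Matrix.cons_val_zero, Matrix.cons_val_one, Matrix.cons_val_fin_one]
  refine Eq.congr_left ?_
  linear_combination (-ρ' * Real.sin ψ - ρ * α' * Real.cos ψ) * h1

/-- A regular curve in the punctured complex plane has a logarithm. -/
theorem exists_log_lift {z z' : ℝ → ℂ} {I : Set ℝ} (hI : IsOpen I) (hI' : I.OrdConnected)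
    (hz : ∀ t ∈ I, HasDerivAt z (z' t) t) (hz' : ContinuousOn z' I) (h0 : ∀ t ∈ I, z t ≠ 0)
    {t₀ : ℝ} (ht₀ : t₀ ∈ I) {w : ℂ} (hw : Complex.exp w = z t₀) :
    ∃ l : ℝ → ℂ, l t₀ = w ∧
      ∀ t ∈ I, Complex.exp (l t) = z t ∧ HasDerivAt l (z' t / z t) t := by
  have hcont : ContinuousOn (fun t => z' t / z t) I :=
    hz'.div (fun t ht => (hz t ht).continuousAt.continuousWithinAt) h0
  set l : ℝ → ℂ := fun t => w + ∫ s in t₀..t, z' s / z s with hl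
  have hd : ∀ t ∈ I, HasDerivAt l (z' t / z t) t := fun t ht =>
    (hasDerivAt_integral_of_continuousOn hI hI' hcont ht₀ ht).const_add w
  have hl0 : l t₀ = w := by simp [hl]
  refine ⟨l, hl0, fun t ht => ⟨?_, hd t ht⟩⟩
  have hq : ∀ s ∈ I, HasDerivAt (fun s => Complex.exp (l s) / z s) 0 s := by
    intro s hs
    refine ((hd s hs).cexp.div (hz s hs) (h0 s hs)).congr_deriv ?_
    have := h0 s hs
    field_simp
    ring
  have h1 := hI.is_const_of_deriv_eq_zero hI'.isPreconnected
    (fun s hs => (hq s hs).differentiableAt.differentiableWithinAt)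
    (fun s hs => (hq s hs).deriv) ht ht₀
  rw [hl0, hw, div_self (h0 _ ht₀), div_eq_one_iff_eq (h0 t ht)] at h1
  exact h1

theorem hasDerivAt_planeToComplex {γ : ℝ → Plane} {v : Plane} {t : ℝ} (h : HasDerivAt γ v t) :
    HasDerivAt (fun s => planeToComplex (γ s)) (planeToComplex v) t := by
  have heq : ∀ p : Plane, planeToComplex p = (p 0 : ℂ) + (p 1 : ℂ) * Complex.I := fun p => by
    apply Complex.ext <;> simp [planeToComplex]
  simp only [heq]
  have h0 := (hasDerivAt_pi.1 h 0).ofReal_comp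
  have h1 := (hasDerivAt_pi.1 h 1).ofReal_comp
  exact h0.add (h1.mul_const _)

theorem IsFieldCurve.exists_polar_lift {L : Plane → Submodule ℝ Plane} {I : Set ℝ}
    {γ : ℝ → Plane} (h : IsFieldCurve L I γ) {t₀ : ℝ} (ht₀ : t₀ ∈ I) {r a : ℝ} (hr : 0 < r)
    (h0 : γ t₀ = polar r a) :
    ∃ ρ α ρ' α' : ℝ → ℝ, ρ t₀ = r ∧ α t₀ = a ∧ ∀ t ∈ I, 0 < ρ t ∧ γ t = polar (ρ t) (α t) ∧
      HasDerivAt ρ (ρ' t) t ∧ HasDerivAt α (α' t) t := by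
  have hd : ∀ t ∈ I, HasDerivAt γ (deriv γ t) t := fun t ht =>
    ((h.contDiffOn.differentiableOn one_ne_zero).differentiableAt
      (h.isOpen.mem_nhds ht)).hasDerivAt
  obtain ⟨l, hl0, hl⟩ := exists_log_lift (z := fun t => planeToComplex (γ t))
    (z' := fun t => planeToComplex (deriv γ t)) h.isOpen h.ordConnected
    (fun t ht => hasDerivAt_planeToComplex (hd t ht))
    (continuous_planeToComplex.comp_continuousOn
      (h.contDiffOn.continuousOn_deriv_of_isOpen h.isOpen le_rfl))
    (fun t ht => planeToComplex_eq_zero.not.2 (h.ne_zero t ht)) ht₀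
    (w := (Real.log r : ℂ) + a * Complex.I) (by
      rw [h0, planeToComplex_polar, Complex.exp_add, ← Complex.ofReal_exp, Real.exp_log hr])
  have hre : ∀ t ∈ I, HasDerivAt (fun s => (l s).re)
      (planeToComplex (deriv γ t) / planeToComplex (γ t)).re t := fun t ht =>
    Complex.reCLM.hasFDerivAt.comp_hasDerivAt t (hl t ht).2
  have him : ∀ t ∈ I, HasDerivAt (fun s => (l s).im)
      (planeToComplex (deriv γ t) / planeToComplex (γ t)).im t := fun t ht =>
    Complex.imCLM.hasFDerivAt.comp_hasDerivAt t (hl t ht).2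
  refine ⟨fun t => Real.exp (l t).re, fun t => (l t).im, _, _, ?_, ?_, fun t ht =>
    ⟨Real.exp_pos _, ?_, (hre t ht).exp, him t ht⟩⟩
  · simp [hl0, Real.exp_log hr]
  · simp [hl0]
  · apply planeToComplex_injective
    rw [planeToComplex_polar, ← (hl t ht).1, Complex.ofReal_exp, ← Complex.exp_add,
      Complex.re_add_im]

/-- The angle from `L` to the radial direction is `Ψ`, as a function of the polar angle. -/
def HasRadialAngle (L : Plane → Submodule ℝ Plane) (Ψ : ℝ → ℝ) : Prop :=
  ∀ r a : ℝ, 0 < r → L (polar r a) = Submodule.span ℝ {polar 1 (a - Ψ a)}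

section

variable {L : Plane → Submodule ℝ Plane} {Ψ : ℝ → ℝ} {N : ℤ}

theorem HasRadialAngle.isFieldCurve_ray (hL : HasRadialAngle L Ψ) {a : ℝ}
    (ha : Real.sin (Ψ a) = 0) : IsFieldCurve L (Set.Ioi 0) fun t => polar t a := by
  have heq : (fun t => polar t a) = fun t : ℝ => t • polar 1 a := by
    funext t
    ext i
    fin_cases i <;> simp [polar]
  have hd : ∀ t : ℝ, HasDerivAt (fun t => polar t a) (polar 1 a) t := fun t => by
    rw [heq]
    simpa using (hasDerivAt_id t).smul_const (polar 1 a)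
  refine ⟨isOpen_Ioi, Set.ordConnected_Ioi, ?_, fun t ht => polar_ne_zero ht a, fun t _ => ?_,
    fun t ht => ?_⟩
  · rw [heq]
    exact (contDiff_id.smul contDiff_const).contDiffOn
  · rw [(hd t).deriv]
    exact polar_ne_zero one_pos a
  · rw [(hd t).deriv, hL t a ht]
    have := polar_tangent_mem_span_iff (ρ := 0) (ρ' := 1) (α := a) (α' := 0) (ψ := Ψ a)
    simp only [one_mul, zero_mul, sub_zero, add_zero, ha] at this
    simpa [polar] using this

/-- Parametrized by the polar angle, the equation of the leaves is `r' = -r cot Ψ`, which the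
amplitude integrates: `r` times the amplitude is the constant `R`. -/
theorem HasRadialAngle.isFieldCurve_graph (hL : HasRadialAngle L Ψ) (h : IsPhase Ψ N)
    (hN : 0 < N) (i : ℤ) {R : ℝ} (hR : 0 < R) :
    IsFieldCurve L (Set.Ioo (h.node hN i) (h.node hN (i + 1)))
      fun t => polar (R / phaseAmplitude Ψ (h.mid hN i) t) t := by
  set I := Set.Ioo (h.node hN i) (h.node hN (i + 1)) with hI
  set ρ : ℝ → ℝ := fun t => R / phaseAmplitude Ψ (h.mid hN i) t with hρ
  have hρp : ∀ t, 0 < ρ t := fun t => div_pos hR (phaseAmplitude_pos _ _ _)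
  have hρd : ∀ t ∈ I, HasDerivAt ρ (-(ρ t * phaseCot Ψ t)) t := by
    intro t ht
    have h1 := (hasDerivAt_const t R).div (h.hasDerivAt_phaseAmplitude hN (h.mid_mem hN i) ht)
      (phaseAmplitude_pos _ _ _).ne'
    refine h1.congr_deriv ?_
    have := (phaseAmplitude_pos Ψ (h.mid hN i) t).ne'
    simp only [hρ]
    field_simp
    ring
  have hd : ∀ t ∈ I, HasDerivAt (fun t => polar (ρ t) t) _ t := fun t ht =>
    hasDerivAt_polar (hρd t ht) (hasDerivAt_id t)
  have hρc : ContinuousOn ρ I := fun t ht => (hρd t ht).continuousAt.continuousWithinAt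
  refine ⟨isOpen_Ioo, Set.ordConnected_Ioo, ?_, fun t _ => polar_ne_zero (hρp t) t, fun t ht => ?_,
    fun t ht => ?_⟩
  · have h1 := contDiffOn_succ_iff_deriv_of_isOpen (𝕜 := ℝ) (n := 0)
      (f := fun t => polar (ρ t) t) (s := I) isOpen_Ioo
    rw [zero_add] at h1
    refine h1.2 ⟨fun t ht => (hd t ht).differentiableAt.differentiableWithinAt, by simp,
      contDiffOn_zero.2 ?_⟩
    refine ContinuousOn.congr ?_ fun t ht => (hd t ht).deriv
    have hc := h.continuousOn_phaseCot hN i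
    refine continuousOn_pi.2 fun j => ?_
    fin_cases j
    · simp only [Fin.zero_eta, Matrix.cons_val_zero, mul_one]
      fun_prop
    · simp only [Fin.mk_one, Matrix.cons_val_one, Matrix.cons_val_fin_one, mul_one]
      fun_prop
  · rw [(hd t ht).deriv]
    intro h0
    have h1 := congrFun h0 0
    have h2 := congrFun h0 1
    simp only [Matrix.cons_val_zero, Matrix.cons_val_one, Matrix.cons_val_fin_one, mul_one,
      Pi.zero_apply] at h1 h2
    have h3 := Real.sin_sq_add_cos_sq t
    refine (hρp t).ne' ?_
    linear_combination (-Real.sin t) * h1 + Real.cos t * h2 - ρ t * h3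
  · rw [(hd t ht).deriv, hL _ _ (hρp t)]
    refine polar_tangent_mem_span_iff.2 ?_
    have := h.sin_ne_zero hN ht
    simp only [phaseCot]
    field_simp
    ring

/-- Along an integral curve in polar coordinates which does not consist of radial directions, the
sector and the first integral are constant. -/
theorem IsPhase.first_integral_const (h : IsPhase Ψ N) (hN : 0 < N) {I : Set ℝ} (hI : IsOpen I)
    (hI' : I.OrdConnected) {ρ α ρ' α' : ℝ → ℝ} (hρp : ∀ t ∈ I, 0 < ρ t)
    (hρ : ∀ t ∈ I, HasDerivAt ρ (ρ' t) t) (hα : ∀ t ∈ I, HasDerivAt α (α' t) t)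
    (hode : ∀ t ∈ I, ρ' t * Real.sin (Ψ (α t)) + ρ t * α' t * Real.cos (Ψ (α t)) = 0)
    {t s : ℝ} (ht : t ∈ I) (hs : s ∈ I) (hne : Real.sin (Ψ (α t)) ≠ 0) :
    ⌊Ψ (α s) / Real.pi⌋ = ⌊Ψ (α t) / Real.pi⌋ ∧
      ρ s * (h.scale hN (α s) * Real.sin (h.angle hN (α s))) =
        ρ t * (h.scale hN (α t) * Real.sin (h.angle hN (α t))) := by
  set u : ℝ → ℝ := fun t => ρ t * (h.scale hN (α t) * Real.sin (h.angle hN (α t))) with hu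
  have hαc : ContinuousOn α I := fun t ht => (hα t ht).continuousAt.continuousWithinAt
  have hρc : ContinuousOn ρ I := fun t ht => (hρ t ht).continuousAt.continuousWithinAt
  have huc : ContinuousOn u I := hρc.mul (((h.continuous_scale hN).comp_continuousOn hαc).mul
    (Real.continuous_sin.comp_continuousOn ((h.continuous_angle hN).comp_continuousOn hαc)))
  have hu0 : ∀ x ∈ I, u x ≠ 0 → Real.sin (Ψ (α x)) ≠ 0 := by
    intro x _ hx h0
    refine hx ?_
    simp only [hu, (h.sin_angle_eq_zero_iff hN).2 h0, mul_zero]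
  -- Inside a sector, `u` is up to sign `ρ` times the amplitude, and the differential equation makes
  -- its derivative vanish.
  have hloc : ∀ x ∈ I, Real.sin (Ψ (α x)) ≠ 0 → ∀ᶠ y in 𝓝 x,
      ⌊Ψ (α y) / Real.pi⌋ = ⌊Ψ (α x) / Real.pi⌋ ∧ u y = u x := by
    intro x hx hsx
    set i := ⌊Ψ (α x) / Real.pi⌋ with hi
    have hmem := h.mem_Ioo hN hsx
    obtain ⟨ε, hε, hball⟩ := Metric.eventually_nhds_iff_ball.1
      ((hI.eventually_mem hx).and ((hα x hx).continuousAt.eventually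
        (Ioo_mem_nhds hmem.1 hmem.2)))
    have hder : ∀ y ∈ Metric.ball x ε, HasDerivAt u 0 y := by
      intro y hy
      obtain ⟨hyI, hyα⟩ := hball y hy
      have h1 := ((hρ y hyI).mul ((h.hasDerivAt_phaseAmplitude hN (h.mid_mem hN i) hyα).comp y
        (hα y hyI))).const_mul ((-1 : ℝ) ^ i)
      have h3 := hode y hyI
      have h4 := h.sin_ne_zero hN hyα
      have h5 : ρ' y * phaseAmplitude Ψ (h.mid hN i) (α y) +
          ρ y * (phaseAmplitude Ψ (h.mid hN i) (α y) * phaseCot Ψ (α y) * α' y) = 0 := by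
        rw [phaseCot]
        field_simp
        linear_combination phaseAmplitude Ψ (h.mid hN i) (α y) * h3
      have h2 := h1.congr_deriv (g' := 0) (by rw [Function.comp, h5, mul_zero])
      refine h2.congr_of_eventuallyEq ?_
      filter_upwards [Metric.isOpen_ball.mem_nhds hy] with z hz
      simp only [hu, h.scale_mul_sin_angle hN (hball z hz).2, Pi.mul_apply, Function.comp]
      ring
    filter_upwards [Metric.ball_mem_nhds x hε] with y hy
    refine ⟨(h.floor_eq_iff hN).2 (Set.Ioo_subset_Ico_self (hball y hy).2), ?_⟩
    exact Metric.isOpen_ball.is_const_of_deriv_eq_zero (convex_ball x ε).isPreconnected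
      (fun z hz => (hder z hz).differentiableAt.differentiableWithinAt)
      (fun z hz => (hder z hz).deriv) hy (Metric.mem_ball_self hε)
  have hut : u t ≠ 0 := mul_ne_zero (hρp t ht).ne' (mul_ne_zero (h.scale_pos hN _).ne'
    ((h.sin_angle_eq_zero_iff hN).not.2 hne))
  -- Connectedness of `I` globalizes the local statement. Points of `U` have `u = u t ≠ 0`, so they
  -- are off the nodes and the local statement applies to them; a curve therefore never reaches a
  -- radial leaf from inside a sector. No uniqueness theorem for differential equations is involved.
  set U : Set ℝ := {x | x ∈ I ∧ ⌊Ψ (α x) / Real.pi⌋ = ⌊Ψ (α t) / Real.pi⌋ ∧ u x = u t} with hU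
  set V : Set ℝ := {x | x ∈ I ∧ ¬(⌊Ψ (α x) / Real.pi⌋ = ⌊Ψ (α t) / Real.pi⌋ ∧ u x = u t)} with hV
  have hUo : IsOpen U := by
    rw [isOpen_iff_mem_nhds]
    rintro x ⟨hx, hx1, hx2⟩
    filter_upwards [hI.mem_nhds hx, hloc x hx (hu0 x hx (hx2 ▸ hut))] with y hy hy'
    exact ⟨hy, hy'.1.trans hx1, hy'.2.trans hx2⟩
  have hVo : IsOpen V := by
    rw [isOpen_iff_mem_nhds]
    rintro x ⟨hx, hx1⟩
    by_cases hxu : u x = u t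
    · filter_upwards [hI.mem_nhds hx, hloc x hx (hu0 x hx (hxu ▸ hut))] with y hy hy'
      exact ⟨hy, fun hc => hx1 ⟨hy'.1.symm.trans hc.1, hxu⟩⟩
    · filter_upwards [hI.mem_nhds hx,
        (huc.continuousAt (hI.mem_nhds hx)).eventually_ne hxu] with y hy hy'
      exact ⟨hy, fun hc => hy' hc.2⟩
  have hsub := hI'.isPreconnected.subset_left_of_subset_union hUo hVo
    (Set.disjoint_left.2 fun x hx hx' => hx'.2 hx.2)
    (fun x hx => by
      by_cases hc : ⌊Ψ (α x) / Real.pi⌋ = ⌊Ψ (α t) / Real.pi⌋ ∧ u x = u t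
      · exact Or.inl ⟨hx, hc⟩
      · exact Or.inr ⟨hx, hc⟩) ⟨t, ht, ht, rfl, rfl⟩
  exact (hsub hs).2

/-- An integral curve stays on one level of the first integral in one sector, or on one ray.
Conversely, two points on such a level or ray are joined by the explicit graph or ray that is an
integral curve. -/
theorem HasRadialAngle.isHorizontalModel (hL : HasRadialAngle L Ψ) (h : IsPhase Ψ N)
    (hN : 0 < N) : IsHorizontalModel L N (h.angle hN) (h.scale hN) where
  continuous_angle := h.continuous_angle hN
  strictMono := h.strictMono_angle hN
  surjective := h.surjective_angle hN
  angle_add := h.angle_add hN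
  continuous_scale := h.continuous_scale hN
  scale_pos := h.scale_pos hN
  scale_add := h.scale_add hN
  leaf_eq := by
    intro r a hr
    ext q
    constructor
    · rintro ⟨I, γ, hγ, ⟨t, ht, hta⟩, ⟨s, hs, rfl⟩⟩
      obtain ⟨ρ, α, ρ', α', rfl, rfl, hlift⟩ := hγ.exists_polar_lift ht hr hta
      have hode : ∀ t ∈ I, ρ' t * Real.sin (Ψ (α t)) + ρ t * α' t * Real.cos (Ψ (α t)) = 0 := by
        intro x hx
        obtain ⟨h1, h2, h3, h4⟩ := hlift x hx
        have h5 := hγ.deriv_mem x hx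
        have h6 : γ =ᶠ[𝓝 x] fun y => polar (ρ y) (α y) := by
          filter_upwards [hγ.isOpen.mem_nhds hx] with y hy using (hlift y hy).2.1
        rw [h2, hL _ _ h1, h6.deriv_eq, (hasDerivAt_polar h3 h4).deriv] at h5
        exact polar_tangent_mem_span_iff.1 h5
      have hconst := fun {x y : ℝ} => h.first_integral_const hN hγ.isOpen hγ.ordConnected (t := x)
        (s := y) (fun z hz => (hlift z hz).1) (fun z hz => (hlift z hz).2.2.1)
        (fun z hz => (hlift z hz).2.2.2) hode
      have hρt := (hlift t ht).1
      refine ⟨ρ s, α s, (hlift s hs).1, (hlift s hs).2.1, ?_⟩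
      rw [h.floor_angle, h.floor_angle]
      by_cases h0 : Real.sin (Ψ (α t)) = 0
      -- A curve that meets a radial leaf is everywhere radial: otherwise its nonzero first integral
      -- would also be nonzero at `t`. Then `sin Ψ = 0` along it, and the equation forces `α' = 0`.
      · have hall : ∀ x ∈ I, Real.sin (Ψ (α x)) = 0 := by
          intro x hx
          by_contra hne
          have h1 := (hconst hx ht hne).2
          rw [(h.sin_angle_eq_zero_iff hN).2 h0, mul_zero, mul_zero] at h1
          exact mul_ne_zero (hlift x hx).1.ne' (mul_ne_zero (h.scale_pos hN _).ne'
            ((h.sin_angle_eq_zero_iff hN).not.2 hne)) h1.symm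
        have hα0 : ∀ x ∈ I, HasDerivAt α 0 x := by
          intro x hx
          refine (hlift x hx).2.2.2.congr_deriv ?_
          have h1 := hode x hx
          rw [hall x hx, mul_zero, zero_add] at h1
          have h2 : Real.cos (Ψ (α x)) ≠ 0 := fun hc => by
            have := Real.sin_sq_add_cos_sq (Ψ (α x))
            rw [hall x hx, hc] at this
            norm_num at this
          simpa [(hlift x hx).1.ne', h2] using h1
        have heq : α s = α t := hγ.isOpen.is_const_of_deriv_eq_zero hγ.ordConnected.isPreconnected
          (fun x hx => (hα0 x hx).differentiableAt.differentiableWithinAt)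
          (fun x hx => (hα0 x hx).deriv) hs ht
        rw [heq, (h.sin_angle_eq_zero_iff hN).2 h0]
        simp
      · obtain ⟨h1, h2⟩ := hconst ht hs h0
        refine ⟨h1.symm, ?_, fun hc => absurd ((h.sin_angle_eq_zero_iff hN).1 hc) h0⟩
        rw [mul_assoc, mul_assoc, h2]
    · rintro ⟨r', a', hr', rfl, h1, h2, h3⟩
      rw [h.floor_angle, h.floor_angle] at h1
      by_cases h0 : Real.sin (Ψ a) = 0
      · obtain rfl := (h.strictMono_angle hN).injective (h3 ((h.sin_angle_eq_zero_iff hN).2 h0))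
        exact ⟨_, _, hL.isFieldCurve_ray h0, ⟨r, hr, rfl⟩, ⟨r', hr', rfl⟩⟩
      · have h0' : Real.sin (Ψ a') ≠ 0 := by
          intro hc
          rw [(h.sin_angle_eq_zero_iff hN).2 hc, mul_zero] at h2
          exact mul_ne_zero (mul_pos hr (h.scale_pos hN a)).ne'
            ((h.sin_angle_eq_zero_iff hN).not.2 h0) h2
        have hm := h.mem_Ioo hN h0
        have hm' := h.mem_Ioo hN h0'
        rw [← h1] at hm'
        have hw := phaseAmplitude_pos Ψ (h.mid hN ⌊Ψ a / Real.pi⌋) a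
        have hw' := phaseAmplitude_pos Ψ (h.mid hN ⌊Ψ a / Real.pi⌋) a'
        rw [mul_assoc, mul_assoc, h.scale_mul_sin_angle hN hm, h.scale_mul_sin_angle hN hm',
          mul_left_comm, mul_left_comm r', mul_right_inj' (zpow_ne_zero _ (by norm_num))] at h2
        refine ⟨_, _, hL.isFieldCurve_graph h hN ⌊Ψ a / Real.pi⌋ (mul_pos hr hw),
          ⟨a, hm, ?_⟩, ⟨a', hm', ?_⟩⟩
        · simp only [mul_div_cancel_right₀ _ hw.ne']
        · simp only [h2, mul_div_cancel_right₀ _ hw'.ne']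

/-- The angle `α - Ψ α` of the line changes by `2 π - N π` in a turn. -/
theorem HasRadialAngle.hasIndex (hL : HasRadialAngle L Ψ) (h : IsPhase Ψ N) :
    HasIndex L (((2 - N : ℤ) : ℝ) / 2) := by
  rintro Γ ⟨ρ, α, -, hα, hΓ, -, hα1⟩
  refine ⟨fun t => α t - Ψ (α t), hα.sub (h.continuous.comp_continuousOn hα), fun t ht => ?_, ?_⟩
  · rw [(hΓ t ht).2, hL _ _ (hΓ t ht).1]
  · simp only [hα1, h.add_two_pi]
    push_cast
    ring

end

/-! ### Winding numbers of periodic curves. -/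

/-- The closed curve `X`, of period `2 * π`, has winding number `n` around the origin. -/
def HasWinding (X : ℝ → ℂ) (n : ℤ) : Prop :=
  ∃ η : ℝ → ℝ, Continuous η ∧ (∀ a, η (a + 2 * Real.pi) = η a + n * (2 * Real.pi)) ∧
    ∀ a, X a = ‖X a‖ * Complex.exp (η a * Complex.I)

/-- Take the imaginary part of a logarithm. By periodicity of `X' / X`, its increment over a period
does not depend on the starting point, and at `0` it is a multiple of `2 π i`. -/
theorem exists_hasWinding {X X' : ℝ → ℂ} (hX : ∀ a, HasDerivAt X (X' a) a) (hX' : Continuous X')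
    (h0 : ∀ a, X a ≠ 0) (hper : ∀ a, X (a + 2 * Real.pi) = X a)
    (hper' : ∀ a, X' (a + 2 * Real.pi) = X' a) : ∃ n, HasWinding X n := by
  obtain ⟨l, -, hl⟩ := exists_log_lift isOpen_univ Set.ordConnected_univ (fun a _ => hX a)
    hX'.continuousOn (fun a _ => h0 a) (Set.mem_univ 0) (Complex.exp_log (h0 0))
  have hexp : ∀ a, Complex.exp (l a) = X a := fun a => (hl a trivial).1
  have hd : ∀ a, HasDerivAt l (X' a / X a) a := fun a => (hl a trivial).2
  obtain ⟨n, hn⟩ := Complex.exp_eq_exp_iff_exists_int.1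
    ((hexp (0 + 2 * Real.pi)).trans ((hper 0).trans (hexp 0).symm))
  have hshift : ∀ a, l (a + 2 * Real.pi) = l a + n * (2 * Real.pi * Complex.I) := by
    intro a
    have hq : ∀ b, HasDerivAt (fun b => l (b + 2 * Real.pi) - l b) 0 b := fun b =>
      (((hd (b + 2 * Real.pi)).comp_add_const b (2 * Real.pi)).sub (hd b)).congr_deriv (by
        rw [hper, hper', sub_self])
    have := is_const_of_deriv_eq_zero (fun b => (hq b).differentiableAt) (fun b => (hq b).deriv) a 0
    linear_combination this + hn
  refine ⟨n, fun a => (l a).im, Complex.continuous_im.comp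
    (continuous_iff_continuousAt.2 fun a => (hd a).continuousAt), fun a => ?_, fun a => ?_⟩
  · simp [hshift a]
  · rw [← hexp a, Complex.norm_exp, Complex.ofReal_exp, ← Complex.exp_add, Complex.re_add_im]

/-- If `Y` never points opposite to `X`, the principal argument of `Y / X` is continuous and
periodic; adding it to an angle of `X` gives an angle of `Y` with the same increment. -/
theorem HasWinding.of_slitPlane {X Y : ℝ → ℂ} {n : ℤ} (h : HasWinding X n) (hX : Continuous X)
    (hY : Continuous Y) (hXp : ∀ a, X (a + 2 * Real.pi) = X a)
    (hYp : ∀ a, Y (a + 2 * Real.pi) = Y a) (hX0 : ∀ a, X a ≠ 0)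
    (hs : ∀ a, Y a / X a ∈ Complex.slitPlane) : HasWinding Y n := by
  obtain ⟨η, hη, hηp, hηX⟩ := h
  refine ⟨fun a => η a + (Y a / X a).arg, hη.add (continuous_iff_continuousAt.2 fun a =>
    ContinuousAt.comp (f := fun a => Y a / X a) (Complex.continuousAt_arg (hs a))
      (hY.div hX hX0).continuousAt), fun a => ?_, fun a => ?_⟩
  · simp only [hXp, hYp, hηp]
    ring
  · have h1 := Complex.norm_mul_exp_arg_mul_I (Y a / X a)
    have h2 : Y a = X a * (Y a / X a) := by
      have := hX0 a
      field_simp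
    have h3 : (‖X a‖ : ℂ) ≠ 0 := by simpa using hX0 a
    have h4 : Y a = ‖X a‖ * Complex.exp (η a * Complex.I) *
        (‖Y a / X a‖ * Complex.exp ((Y a / X a).arg * Complex.I)) := by
      rw [h1, ← hηX a]
      exact h2
    refine h4.trans ?_
    rw [norm_div]
    push_cast
    rw [add_mul, Complex.exp_add]
    field_simp

theorem mem_slitPlane_div_iff {z w : ℂ} (hw : w ≠ 0) :
    z / w ∈ Complex.slitPlane ↔
      0 < z.re * w.re + z.im * w.im ∨ z.im * w.re - z.re * w.im ≠ 0 := by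
  have hn : 0 < Complex.normSq w := Complex.normSq_pos.2 hw
  rw [Complex.mem_slitPlane_iff, Complex.div_re, Complex.div_im, ← add_div, ← sub_div,
    div_pos_iff_of_pos_right hn, div_ne_zero_iff, and_iff_left hn.ne']

/-- Since `f a = 0`, continuity of `g` is enough. It serves a factor built from `Ψ` and `C`, which
are only known to be continuous. -/
theorem HasDerivAt.mul_of_eq_zero {f g : ℝ → ℝ} {f' a : ℝ} (hf : HasDerivAt f f' a)
    (h0 : f a = 0) (hg : ContinuousAt g a) : HasDerivAt (fun x => f x * g x) (f' * g a) a := by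
  rw [hasDerivAt_iff_tendsto_slope] at hf ⊢
  refine (hf.mul (hg.mono_left nhdsWithin_le_nhds)).congr fun x => ?_
  simp only [slope_def_field, h0, zero_mul, sub_zero]
  rw [div_mul_eq_mul_div]

theorem HasDerivAt.of_sin {f : ℝ → ℝ} {f' a : ℝ} (hf : ContinuousAt f a)
    (h0 : Real.sin (f a) = 0) (hd : HasDerivAt (fun x => Real.sin (f x)) f' a) :
    HasDerivAt f (f' * Real.cos (f a)) a := by
  have h1 : HasDerivAt (fun x => Real.sin (f x - f a)) (f' * Real.cos (f a)) a := by
    simpa only [Real.sin_sub, h0, mul_zero, sub_zero] using hd.mul_const (Real.cos (f a))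
  have h2 : HasDerivAt Real.arcsin 1 (Real.sin (f a - f a)) := by
    rw [sub_self, Real.sin_zero]
    simpa using Real.hasDerivAt_arcsin (x := 0) (by norm_num) (by norm_num)
  have h3 := (h2.comp a h1).add_const (f a)
  rw [one_mul] at h3
  refine h3.congr_of_eventuallyEq ?_
  have h4 : ∀ᶠ x in 𝓝 a, f x - f a ∈ Set.Ioo (-(Real.pi / 2)) (Real.pi / 2) := by
    refine (hf.sub continuousAt_const).eventually (Ioo_mem_nhds ?_ ?_) <;>
      simp [Real.pi_pos]
  filter_upwards [h4] with x hx
  simp [Real.arcsin_sin hx.1.le hx.2.le]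

/-! ### Phases of the asymptotic directions of a hyperbolic trace. -/

/-- The restriction `F` to the unit circle of a function on the plane which is homogeneous of degree
`m` and whose Hessian is indefinite off the origin: `F₁` is the derivative of `F` and `C` is the
second derivative along the circle direction. -/
structure IsHyperbolicTrace (m : ℝ) (F F₁ C : ℝ → ℝ) : Prop where
  one_lt : 1 < m
  hasDerivAt : ∀ a, HasDerivAt F (F₁ a) a
  hasDerivAt' : ∀ a, HasDerivAt F₁ (C a - m * F a) a
  continuous : Continuous C
  add_two_pi : ∀ a, F (a + 2 * Real.pi) = F a
  add_two_pi' : ∀ a, F₁ (a + 2 * Real.pi) = F₁ a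
  add_two_pi'' : ∀ a, C (a + 2 * Real.pi) = C a
  discr_pos : ∀ a, 0 < ((m - 1) * F₁ a) ^ 2 - m * (m - 1) * F a * C a

/-- The curve `(F, F')` in the complex plane. -/
noncomputable def jetCurve (F F₁ : ℝ → ℝ) (a : ℝ) : ℂ := ⟨F a, F₁ a⟩

theorem continuous_complex_mk {f g : ℝ → ℝ} (hf : Continuous f) (hg : Continuous g) :
    Continuous fun a => (⟨f a, g a⟩ : ℂ) := by
  have : (fun a => (⟨f a, g a⟩ : ℂ)) = fun a => (f a : ℂ) + (g a : ℂ) * Complex.I := by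
    funext a
    apply Complex.ext <;> simp
  rw [this]
  fun_prop

theorem hasDerivAt_complex_mk {f g : ℝ → ℝ} {f' g' a : ℝ} (hf : HasDerivAt f f' a)
    (hg : HasDerivAt g g' a) : HasDerivAt (fun a => (⟨f a, g a⟩ : ℂ)) ⟨f', g'⟩ a := by
  have h1 : (fun a => (⟨f a, g a⟩ : ℂ)) = fun a => (f a : ℂ) + (g a : ℂ) * Complex.I := by
    funext a
    apply Complex.ext <;> simp
  rw [h1]
  refine (hf.ofReal_comp.add (hg.ofReal_comp.mul_const _)).congr_deriv ?_
  apply Complex.ext <;> simp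

namespace IsHyperbolicTrace

variable {m : ℝ} {F F₁ C : ℝ → ℝ} (h : IsHyperbolicTrace m F F₁ C)
include h

theorem continuous_fst : Continuous F :=
  continuous_iff_continuousAt.2 fun a => (h.hasDerivAt a).continuousAt

theorem continuous_snd : Continuous F₁ :=
  continuous_iff_continuousAt.2 fun a => (h.hasDerivAt' a).continuousAt

theorem ne_zero_of_eq_zero {a : ℝ} (ha : F a = 0) : F₁ a ≠ 0 := by
  intro h1
  have := h.discr_pos a
  simp [ha, h1] at this

theorem jetCurve_ne_zero (a : ℝ) : jetCurve F F₁ a ≠ 0 := fun h0 =>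
  h.ne_zero_of_eq_zero (congrArg Complex.re h0) (congrArg Complex.im h0)

theorem continuous_jetCurve : Continuous (jetCurve F F₁) :=
  continuous_complex_mk h.continuous_fst h.continuous_snd

theorem jetCurve_add (a : ℝ) : jetCurve F F₁ (a + 2 * Real.pi) = jetCurve F F₁ a := by
  rw [jetCurve, h.add_two_pi, h.add_two_pi', jetCurve]

theorem exists_hasWinding_jetCurve : ∃ n, HasWinding (jetCurve F F₁) n := by
  refine exists_hasWinding (X' := fun a => ⟨F₁ a, C a - m * F a⟩)
    (fun a => hasDerivAt_complex_mk (h.hasDerivAt a) (h.hasDerivAt' a))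
    (continuous_complex_mk h.continuous_snd
      (h.continuous.sub (continuous_const.mul h.continuous_fst)))
    h.jetCurve_ne_zero h.jetCurve_add fun a => ?_
  rw [h.add_two_pi, h.add_two_pi', h.add_two_pi'']

/-- Without zeros, `F' / F` would be differentiable and periodic, while the discriminant inequality
makes its derivative negative. -/
theorem exists_eq_zero : ∃ a, F a = 0 := by
  by_contra! h0
  have hanti : StrictAnti fun a => F₁ a / F a := by
    refine strictAnti_of_deriv_neg fun a => ?_
    refine ((h.hasDerivAt' a).div (h.hasDerivAt a) (h0 a)).deriv.trans_lt ?_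
    refine div_neg_of_neg_of_pos ?_ (by have := h0 a; positivity)
    have h1 := h.discr_pos a
    have hm := h.one_lt
    have h2 : 0 < (m - 1) * ((m - 1) * F₁ a ^ 2 - m * (F a * C a)) := by linarith
    have h3 := (pos_iff_pos_of_mul_pos h2).1 (by linarith)
    have h4 : 0 < F a ^ 2 := by have := h0 a; positivity
    have h5 := sq_nonneg (F₁ a)
    have h6 : m * ((C a - m * F a) * F a - F₁ a * F₁ a) < 0 := by
      linarith [sq_nonneg (m * F a)]
    exact neg_of_mul_neg_right h6 (by linarith)
  have h1 := hanti (show (0 : ℝ) < 0 + 2 * Real.pi by linarith [Real.pi_pos])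
  simp only [h.add_two_pi, h.add_two_pi'] at h1
  exact h1.false

/-- The traceless part of the Hessian in the polar frame, as a complex number. -/
theorem hasWinding_traceless {n : ℤ} (hn : HasWinding (jetCurve F F₁) n) :
    HasWinding (fun a => ⟨(m * (m - 1) * F a - C a) / 2, (m - 1) * F₁ a⟩) n := by
  have hF := h.continuous_fst
  have hF₁ := h.continuous_snd
  have hC := h.continuous
  refine hn.of_slitPlane h.continuous_jetCurve (continuous_complex_mk (by fun_prop) (by fun_prop))
    h.jetCurve_add (fun a => by rw [h.add_two_pi, h.add_two_pi', h.add_two_pi''])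
    h.jetCurve_ne_zero fun a => ?_
  rw [mem_slitPlane_div_iff (h.jetCurve_ne_zero a)]
  simp only [jetCurve]
  have hm := h.one_lt
  have hd := h.discr_pos a
  -- The two vectors are never opposite. If `F' = 0`, the discriminant gives `F C < 0` and their
  -- inner product is positive. If `F' ≠ 0` and they are parallel, comparing second coordinates
  -- shows that the factor is `m - 1 > 0`.
  by_cases h1 : F₁ a = 0
  · left
    rw [h1] at hd ⊢
    have h2 : 0 < (m * (m - 1)) * -(F a * C a) := by linarith
    have h3 := (pos_iff_pos_of_mul_pos h2).1 (mul_pos (by linarith) (by linarith))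
    have h4 : 0 ≤ m * (m - 1) * F a ^ 2 :=
      mul_nonneg (mul_nonneg (by linarith) (by linarith)) (sq_nonneg _)
    nlinarith
  · by_cases h2 : (m - 1) * F₁ a * F a - (m * (m - 1) * F a - C a) / 2 * F₁ a = 0
    · left
      have h3 : (m * (m - 1) * F a - C a) / 2 = (m - 1) * F a := by
        have : F₁ a * ((m * (m - 1) * F a - C a) / 2 - (m - 1) * F a) = 0 := by linarith
        rcases mul_eq_zero.1 this with h4 | h4
        · exact absurd h4 h1
        · linarith
      rw [h3]
      have h5 : 0 < (m - 1) * F₁ a ^ 2 := mul_pos (by linarith) (by positivity)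
      have h6 : 0 ≤ (m - 1) * F a ^ 2 := mul_nonneg (by linarith) (sq_nonneg _)
      nlinarith
    · exact Or.inr h2

end IsHyperbolicTrace

namespace IsHyperbolicTrace

variable {m : ℝ} {F F₁ C : ℝ → ℝ} (h : IsHyperbolicTrace m F F₁ C)
include h

theorem isPhase_of_null {n : ℤ} {Ψ : ℝ → ℝ} (hΨ : Continuous Ψ)
    (hper : ∀ a, Ψ (a + 2 * Real.pi) = Ψ a + n * Real.pi)
    (hnull : ∀ a, m * (m - 1) * F a * Real.cos (Ψ a) ^ 2 -
      2 * ((m - 1) * F₁ a) * Real.cos (Ψ a) * Real.sin (Ψ a) + C a * Real.sin (Ψ a) ^ 2 = 0) :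
    IsPhase Ψ n := by
  refine ⟨hΨ, hper, fun a ha => ?_⟩
  have hm := h.one_lt
  have hcos : Real.cos (Ψ a) ≠ 0 := fun hc => by
    have := Real.sin_sq_add_cos_sq (Ψ a)
    rw [ha, hc] at this
    norm_num at this
  have hF : F a = 0 := by
    have h1 := hnull a
    have h2 : m - 1 ≠ 0 := by linarith
    have h3 : m ≠ 0 := by linarith
    simpa [ha, hcos, h2, h3] using h1
  have hF₁ := h.ne_zero_of_eq_zero hF
  -- The null equation reads `sin Ψ * D = m (m - 1) F cos² Ψ`. Near `a`, where `D ≠ 0`, it expresses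
  -- `sin Ψ` by the differentiable function `F` times a continuous one; as `F a = 0`, this yields
  -- the derivative `m / 2 * cos² (Ψ a)` of `Ψ` at `a`.
  set D : ℝ → ℝ := fun x => 2 * ((m - 1) * F₁ x) * Real.cos (Ψ x) - C x * Real.sin (Ψ x) with hD
  have hcF₁ := h.continuous_snd
  have hcC := h.continuous
  have hDc : Continuous D := by fun_prop
  have hDa : D a = 2 * ((m - 1) * F₁ a) * Real.cos (Ψ a) := by simp [hD, ha]
  have hD0 : D a ≠ 0 := by
    rw [hDa]
    exact mul_ne_zero (mul_ne_zero two_ne_zero (mul_ne_zero (by linarith) hF₁)) hcos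
  have h1 : HasDerivAt (fun x => m * (m - 1) * F x * (Real.cos (Ψ x) ^ 2 / D x))
      (m * (m - 1) * F₁ a * (Real.cos (Ψ a) ^ 2 / D a)) a :=
    ((h.hasDerivAt a).const_mul _).mul_of_eq_zero (by simp [hF])
      (ContinuousAt.div (by fun_prop) hDc.continuousAt hD0)
  have h2 : HasDerivAt (fun x => Real.sin (Ψ x))
      (m * (m - 1) * F₁ a * (Real.cos (Ψ a) ^ 2 / D a)) a := by
    refine h1.congr_of_eventuallyEq ?_
    filter_upwards [hDc.continuousAt.eventually_ne hD0] with x hx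
    rw [← mul_div_assoc, eq_div_iff hx]
    linear_combination (-1 : ℝ) * hnull x
  refine ⟨_, ?_, HasDerivAt.of_sin hΨ.continuousAt ha h2⟩
  have h3 : m * (m - 1) * F₁ a * (Real.cos (Ψ a) ^ 2 / D a) * Real.cos (Ψ a) =
      m / 2 * Real.cos (Ψ a) ^ 2 := by
    rw [hDa]
    have h4 : m - 1 ≠ 0 := by linarith
    field_simp
  rw [h3]
  have h5 : 0 < Real.cos (Ψ a) ^ 2 := by positivity
  exact mul_pos (by linarith) h5

/-- Each of the two null directions of the Hessian, distinguished by `ε`, makes with the radial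
direction an angle which is the opposite of a phase. -/
theorem exists_phase {n : ℤ} (hn : HasWinding (jetCurve F F₁) n) {ε : ℝ} (hε : ε ^ 2 = 1) :
    ∃ Ψ, IsPhase Ψ (-n) ∧ ∀ a,
      m * (m - 1) * F a * Real.cos (Ψ a) ^ 2 -
        2 * ((m - 1) * F₁ a) * Real.cos (Ψ a) * Real.sin (Ψ a) + C a * Real.sin (Ψ a) ^ 2 = 0 ∧
      0 < ε * ((m * (m - 1) * F a - C a) * Real.cos (Ψ a) * Real.sin (Ψ a) +
        (m - 1) * F₁ a * (Real.cos (Ψ a) ^ 2 - Real.sin (Ψ a) ^ 2)) := by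
  have hF := h.continuous_fst
  have hF₁ := h.continuous_snd
  have hC := h.continuous
  set A : ℝ → ℝ := fun a => m * (m - 1) * F a with hA
  set B : ℝ → ℝ := fun a => (m - 1) * F₁ a with hB
  set d : ℝ → ℝ := fun a => √(B a ^ 2 - A a * C a) with hd
  have hdisc : ∀ a, 0 < B a ^ 2 - A a * C a := h.discr_pos
  have hdpos : ∀ a, 0 < d a := fun a => Real.sqrt_pos.2 (hdisc a)
  have hdsq : ∀ a, d a ^ 2 = B a ^ 2 - A a * C a := fun a => Real.sq_sqrt (hdisc a).le
  have hε0 : ε ≠ 0 := fun h0 => by simp [h0] at hε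
  have hAper : ∀ a, A (a + 2 * Real.pi) = A a := fun a => by simp only [hA, h.add_two_pi]
  have hBper : ∀ a, B (a + 2 * Real.pi) = B a := fun a => by simp only [hB, h.add_two_pi']
  have hdper : ∀ a, d (a + 2 * Real.pi) = d a := fun a => by
    simp only [hd, hAper, hBper, h.add_two_pi'']
  have hAc : Continuous A := by fun_prop
  have hBc : Continuous B := by fun_prop
  have hdc : Continuous d := by fun_prop
  -- With `φ = -2 Ψ`, the null equation says that `conj τ * exp (i φ)` has real part `-(A + C) / 2`,
  -- and the choice of null direction fixes its imaginary part as `-ε d`. So `exp (i φ)` is `τ κ`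
  -- divided by its norm. As `κ` is never real, `τ κ` has the winding number of `τ`.
  set τ : ℝ → ℂ := fun a => ⟨(A a - C a) / 2, B a⟩ with hτ
  set κ : ℝ → ℂ := fun a => ⟨-((A a + C a) / 2), -(ε * d a)⟩ with hκ
  have hτn : ∀ a, ‖τ a‖ ^ 2 = ((A a + C a) / 2) ^ 2 + d a ^ 2 := fun a => by
    rw [← Complex.normSq_eq_norm_sq, Complex.normSq_mk, hdsq]
    ring
  have hκn : ∀ a, ‖κ a‖ ^ 2 = ((A a + C a) / 2) ^ 2 + d a ^ 2 := fun a => by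
    rw [← Complex.normSq_eq_norm_sq, Complex.normSq_mk]
    linear_combination d a ^ 2 * hε
  have hSpos : ∀ a, 0 < ((A a + C a) / 2) ^ 2 + d a ^ 2 := fun a => by
    have := hdpos a
    positivity
  have hτ0 : ∀ a, τ a ≠ 0 := fun a h0 => by
    have := hτn a
    rw [h0, norm_zero] at this
    linarith [hSpos a]
  have hYn : ∀ a, ‖τ a * κ a‖ = ((A a + C a) / 2) ^ 2 + d a ^ 2 := fun a => by
    have h1 : ‖τ a‖ = ‖κ a‖ :=
      (pow_left_inj₀ (norm_nonneg _) (norm_nonneg _) two_ne_zero).1 ((hτn a).trans (hκn a).symm)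
    rw [norm_mul, ← h1, ← sq, hτn]
  have hτc : Continuous τ := continuous_complex_mk (by fun_prop) (by fun_prop)
  have hκc : Continuous κ := continuous_complex_mk (by fun_prop) (by fun_prop)
  have hτper : ∀ a, τ (a + 2 * Real.pi) = τ a := fun a => by
    simp only [hτ, hAper, hBper, h.add_two_pi'']
  obtain ⟨φ, hφ, hφper, hφY⟩ := HasWinding.of_slitPlane (Y := fun a => τ a * κ a)
    (h.hasWinding_traceless hn) hτc (hτc.mul hκc) hτper
    (fun a => by simp only [hτper]; simp only [hκ, hAper, hdper, h.add_two_pi''])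
    hτ0 (fun a => by
      rw [mul_div_assoc, mul_comm, div_mul_cancel₀ _ (hτ0 a)]
      exact Or.inr (neg_ne_zero.2 (mul_ne_zero hε0 (hdpos a).ne')))
  have hkey : ∀ a, A a * Real.cos (-φ a / 2) ^ 2 -
      2 * B a * Real.cos (-φ a / 2) * Real.sin (-φ a / 2) + C a * Real.sin (-φ a / 2) ^ 2 = 0 ∧
      0 < ε * ((A a - C a) * Real.cos (-φ a / 2) * Real.sin (-φ a / 2) +
        B a * (Real.cos (-φ a / 2) ^ 2 - Real.sin (-φ a / 2) ^ 2)) := by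
    intro a
    have hS := hSpos a
    have h1 := hφY a
    simp only [hYn] at h1
    have hre := congrArg Complex.re h1
    have him := congrArg Complex.im h1
    rw [Complex.re_ofReal_mul, Complex.exp_ofReal_mul_I_re] at hre
    rw [Complex.im_ofReal_mul, Complex.exp_ofReal_mul_I_im] at him
    simp only [hτ, hκ, Complex.mul_re, Complex.mul_im] at hre him
    have hx : φ a = 2 * (φ a / 2) := by ring
    have hs := Real.sin_sq_add_cos_sq (φ a / 2)
    rw [hx, Real.cos_two_mul'] at hre
    rw [hx, Real.sin_two_mul] at him
    rw [neg_div, Real.cos_neg, Real.sin_neg]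
    have hdd := hdsq a
    set c := Real.cos (φ a / 2)
    set s := Real.sin (φ a / 2)
    constructor
    · refine (mul_eq_zero.1 ?_).resolve_left hS.ne'
      linear_combination (-(A a - C a) / 2) * hre - B a * him +
        (((A a + C a) / 2) ^ 2 + d a ^ 2) * ((A a + C a) / 2) * hs +
          ((A a + C a) / 2) * hdd
    · have h2 : (((A a + C a) / 2) ^ 2 + d a ^ 2) *
          ((A a - C a) * c * -s + B a * (c ^ 2 - (-s) ^ 2)) =
            (((A a + C a) / 2) ^ 2 + d a ^ 2) * (ε * d a) := by
        linear_combination ((A a - C a) / 2) * him - B a * hre - ε * d a * hdd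
      rw [mul_left_cancel₀ hS.ne' h2, ← mul_assoc, ← sq, hε, one_mul]
      exact hdpos a
  refine ⟨fun a => -φ a / 2, ?_, hkey⟩
  refine h.isPhase_of_null (by fun_prop) (fun a => ?_) fun a => (hkey a).1
  rw [hφper]
  push_cast
  ring

/-- At a zero of `F` the radial direction is null. For `ε` the sign of `F'` it is the null direction
selected by `ε`, since the other one has the opposite sign; so the corresponding phase meets a
multiple of `π`. -/
theorem winding_neg {n : ℤ} (hn : HasWinding (jetCurve F F₁) n) : 0 < -n := by
  obtain ⟨a, ha⟩ := h.exists_eq_zero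
  have hF₁ := h.ne_zero_of_eq_zero ha
  have hm := h.one_lt
  obtain ⟨ε, hε, hεF⟩ : ∃ ε : ℝ, ε ^ 2 = 1 ∧ 0 < ε * F₁ a := by
    rcases hF₁.lt_or_gt with hlt | hgt
    · exact ⟨-1, by norm_num, by linarith⟩
    · exact ⟨1, by norm_num, by linarith⟩
  obtain ⟨Ψ, hΨ, hnull⟩ := h.exists_phase hn hε
  obtain ⟨h1, h2⟩ := hnull a
  rw [ha] at h1 h2
  have h3 : Real.sin (Ψ a) = 0 := by
    by_contra hs
    have h4 : C a * Real.sin (Ψ a) = 2 * ((m - 1) * F₁ a) * Real.cos (Ψ a) := by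
      refine mul_left_cancel₀ hs ?_
      linear_combination h1
    have h5 := Real.sin_sq_add_cos_sq (Ψ a)
    have h6 : ε * ((m * (m - 1) * 0 - C a) * Real.cos (Ψ a) * Real.sin (Ψ a) +
        (m - 1) * F₁ a * (Real.cos (Ψ a) ^ 2 - Real.sin (Ψ a) ^ 2)) =
          -((m - 1) * (ε * F₁ a)) := by
      linear_combination (-ε * Real.cos (Ψ a)) * h4 - ε * (m - 1) * F₁ a * h5
    rw [h6] at h2
    have := mul_pos (sub_pos.2 hm) hεF
    linarith
  obtain ⟨i, hi⟩ := Real.sin_eq_zero_iff.1 h3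
  exact hΨ.pos_of_eq hi.symm

end IsHyperbolicTrace

/-- The determinant of `(F, F')` and `(F q, F' q + F q')` is `F ^ 2 q'`. Where it vanishes, either
`F = 0` or `q' = 0`, and the second vector is `q > 0` times the first. -/
theorem hasWinding_jetCurve_mul {m : ℝ} {F F₁ C : ℝ → ℝ} (h : IsHyperbolicTrace m F F₁ C) {n : ℤ}
    (hn : HasWinding (jetCurve F F₁) n) {m' : ℝ} {G G₁ C' : ℝ → ℝ}
    (h' : IsHyperbolicTrace m' G G₁ C') {q q₁ : ℝ → ℝ} (hq : ∀ a, 0 < q a)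
    (hG : ∀ a, G a = F a * q a) (hG₁ : ∀ a, G₁ a = F₁ a * q a + F a * q₁ a) :
    HasWinding (jetCurve G G₁) n := by
  refine hn.of_slitPlane h.continuous_jetCurve h'.continuous_jetCurve h.jetCurve_add
    h'.jetCurve_add h.jetCurve_ne_zero fun a => ?_
  rw [mem_slitPlane_div_iff (h.jetCurve_ne_zero a)]
  simp only [jetCurve, hG, hG₁]
  have hqa := hq a
  by_cases h0 : F a = 0
  · left
    have := h.ne_zero_of_eq_zero h0
    have h1 : 0 < q a * F₁ a ^ 2 := by positivity
    rw [h0]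
    linarith
  · by_cases h1 : q₁ a = 0
    · left
      have h2 : 0 < q a * F a ^ 2 := by positivity
      have h3 : 0 ≤ q a * F₁ a ^ 2 := by positivity
      rw [h1]
      linarith
    · right
      have h2 : (F₁ a * q a + F a * q₁ a) * F a - F a * q a * F₁ a = F a ^ 2 * q₁ a := by ring
      rw [h2]
      positivity

/-! ### Homogeneous polynomials on the unit circle. -/

/-- The commutator of two derivations is a derivation, and this one kills the variables. -/
theorem MvPolynomial.pderiv_pderiv_comm {σ R : Type*} [CommRing R] (i j : σ)
    (f : MvPolynomial σ R) : pderiv i (pderiv j f) = pderiv j (pderiv i f) := by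
  have h : ⁅pderiv (R := R) i, pderiv j⁆ = (0 : Derivation R (MvPolynomial σ R) (MvPolynomial σ R)) := by
    refine MvPolynomial.derivation_ext fun k => ?_
    classical
    rw [Derivation.commutator_apply, pderiv_X, pderiv_X]
    by_cases h1 : j = k <;> by_cases h2 : i = k <;> simp [h1, h2]
  have := congrArg (fun D => D f) h
  rw [Derivation.commutator_apply] at this
  exact sub_eq_zero.1 this

theorem MvPolynomial.IsHomogeneous.eval_smul {σ R : Type*} [CommSemiring R]
    {f : MvPolynomial σ R} {n : ℕ} (hf : f.IsHomogeneous n) (r : R) (x : σ → R) :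
    eval (r • x) f = r ^ n * eval x f := by
  rw [eval_eq, eval_eq, Finset.mul_sum]
  refine Finset.sum_congr rfl fun d hd => ?_
  have h1 : ∑ i ∈ d.support, d i = n := by
    have := hf (mem_support_iff.1 hd)
    simpa [Finsupp.weight_apply, Finsupp.sum] using this
  simp only [Pi.smul_apply, smul_eq_mul, mul_pow, Finset.prod_mul_distrib]
  rw [Finset.prod_pow_eq_pow_sum, h1]
  ring

theorem MvPolynomial.hasDerivAt_eval {f : MvPolynomial (Fin 2) ℝ} {γ : ℝ → Fin 2 → ℝ}
    {v : Fin 2 → ℝ} {t : ℝ} (hγ : ∀ i, HasDerivAt (fun s => γ s i) (v i) t) :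
    HasDerivAt (fun s => eval (γ s) f)
      (eval (γ t) (pderiv 0 f) * v 0 + eval (γ t) (pderiv 1 f) * v 1) t := by
  induction f using MvPolynomial.induction_on with
  | C a => simpa using hasDerivAt_const t a
  | add p q hp hq =>
    simp only [map_add]
    exact (hp.add hq).congr_deriv (by ring)
  | mul_X p i hp =>
    simp only [map_mul, eval_X, pderiv_mul, map_add]
    refine (hp.mul (hγ i)).congr_deriv ?_
    fin_cases i <;> simp [pderiv_X] <;> ring

theorem polar_eq_smul (r a : ℝ) : polar r a = r • polar 1 a := by
  ext i
  fin_cases i <;> simp [polar]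

theorem hess_comm (f : MvPolynomial (Fin 2) ℝ) (p : Plane) : hess f p 1 0 = hess f p 0 1 := by
  simp only [hess, Matrix.of_apply]
  rw [MvPolynomial.pderiv_pderiv_comm]

theorem continuous_hess (f : MvPolynomial (Fin 2) ℝ) (i j : Fin 2) :
    Continuous fun p => hess f p i j :=
  MvPolynomial.continuous_eval _

theorem hess_polar {f : MvPolynomial (Fin 2) ℝ} {m : ℕ} (hf : f.IsHomogeneous m) (r a : ℝ)
    (i j : Fin 2) : hess f (polar r a) i j = r ^ (m - 1 - 1) * hess f (polar 1 a) i j := by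
  rw [polar_eq_smul r a]
  exact (hf.pderiv.pderiv).eval_smul r _

/-- The second fundamental form of `f` at `p`, evaluated on `v` and on `v` turned by a right
angle. -/
noncomputable def crossForm (f : MvPolynomial (Fin 2) ℝ) (p v : Plane) : ℝ :=
  (hess f p 1 1 - hess f p 0 0) * v 0 * v 1 + hess f p 0 1 * (v 0 ^ 2 - v 1 ^ 2)

/-- The restriction of a polynomial to the unit circle. -/
noncomputable def circleTrace (f : MvPolynomial (Fin 2) ℝ) (a : ℝ) : ℝ :=
  MvPolynomial.eval (polar 1 a) f

/-- The derivative of the restriction of a polynomial to the unit circle. -/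
noncomputable def circleDeriv (f : MvPolynomial (Fin 2) ℝ) (a : ℝ) : ℝ :=
  MvPolynomial.eval (polar 1 a) (MvPolynomial.pderiv 1 f) * Real.cos a -
    MvPolynomial.eval (polar 1 a) (MvPolynomial.pderiv 0 f) * Real.sin a

/-- The second derivative of a polynomial on the unit circle in the tangent direction. -/
noncomputable def circleHess (f : MvPolynomial (Fin 2) ℝ) (a : ℝ) : ℝ :=
  secondForm f (polar 1 a) ![-Real.sin a, Real.cos a]

theorem circleTrace_mul (f g : MvPolynomial (Fin 2) ℝ) (a : ℝ) :
    circleTrace (f * g) a = circleTrace f a * circleTrace g a := by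
  simp [circleTrace]

theorem circleDeriv_mul (f g : MvPolynomial (Fin 2) ℝ) (a : ℝ) :
    circleDeriv (f * g) a =
      circleDeriv f a * circleTrace g a + circleTrace f a * circleDeriv g a := by
  simp only [circleDeriv, circleTrace, MvPolynomial.pderiv_mul, map_add, map_mul]
  ring

theorem eval_euler {f : MvPolynomial (Fin 2) ℝ} {m : ℕ} (hf : f.IsHomogeneous m) (p : Plane) :
    p 0 * MvPolynomial.eval p (MvPolynomial.pderiv 0 f) +
      p 1 * MvPolynomial.eval p (MvPolynomial.pderiv 1 f) = m * MvPolynomial.eval p f := by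
  have := congrArg (MvPolynomial.eval p) hf.sum_X_mul_pderiv
  simpa [Fin.sum_univ_two] using this

section

variable {f : MvPolynomial (Fin 2) ℝ} {m : ℕ}

theorem two_le_of_isHyperbolicPoly (hf : f.IsHomogeneous m) (hh : IsHyperbolicPoly f) :
    2 ≤ m := by
  by_contra! hlt
  -- In degree `0` or `1` the first derivatives are homogeneous of degree `0` (the subtraction
  -- truncates), so Euler's identity at `(1, 0)` gives `f_xx = f_xy = 0` there and the discriminant
  -- vanishes.
  have hm : m - 1 = 0 := by omega
  have h1 := hh (polar 1 0) (polar_ne_zero one_pos 0)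
  have h2 := eval_euler (hf.pderiv (i := 0)) (polar 1 0)
  have h3 := eval_euler (hf.pderiv (i := 1)) (polar 1 0)
  rw [hm] at h2 h3
  simp [polar] at h2 h3
  simp [discr, hess, polar, h2, h3] at h1

variable (hf : f.IsHomogeneous m) (hm : 2 ≤ m)
include hf hm

theorem euler_hess (a : ℝ) :
    Real.cos a * hess f (polar 1 a) 0 0 + Real.sin a * hess f (polar 1 a) 0 1 =
        (m - 1) * MvPolynomial.eval (polar 1 a) (MvPolynomial.pderiv 0 f) ∧
      Real.cos a * hess f (polar 1 a) 0 1 + Real.sin a * hess f (polar 1 a) 1 1 =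
        (m - 1) * MvPolynomial.eval (polar 1 a) (MvPolynomial.pderiv 1 f) := by
  have h2 := eval_euler (hf.pderiv (i := 0)) (polar 1 a)
  have h3 := eval_euler (hf.pderiv (i := 1)) (polar 1 a)
  rw [Nat.cast_sub (by omega), Nat.cast_one] at h2 h3
  rw [← h2, ← h3, ← hess_comm]
  constructor
  · simp [hess, polar]
  · rw [hess_comm]
    simp [hess, polar]

theorem circleTrace_eq (a : ℝ) : m * (m - 1) * circleTrace f a =
    hess f (polar 1 a) 0 0 * Real.cos a ^ 2 +
      2 * hess f (polar 1 a) 0 1 * Real.cos a * Real.sin a +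
        hess f (polar 1 a) 1 1 * Real.sin a ^ 2 := by
  obtain ⟨h1, h2⟩ := euler_hess hf hm a
  have h3 := eval_euler hf (polar 1 a)
  simp only [polar, one_mul, Matrix.cons_val_zero, Matrix.cons_val_one,
    Matrix.cons_val_fin_one] at h1 h2 h3
  simp only [circleTrace, polar, one_mul]
  linear_combination (-(m - 1 : ℝ)) * h3 - Real.cos a * h1 - Real.sin a * h2

theorem circleDeriv_eq (a : ℝ) : (m - 1) * circleDeriv f a =
    (hess f (polar 1 a) 1 1 - hess f (polar 1 a) 0 0) * Real.cos a * Real.sin a +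
      hess f (polar 1 a) 0 1 * (Real.cos a ^ 2 - Real.sin a ^ 2) := by
  obtain ⟨h1, h2⟩ := euler_hess hf hm a
  rw [circleDeriv]
  linear_combination Real.sin a * h1 - Real.cos a * h2

/-- By Euler's identity for `f` and its first derivatives, the Hessian in the polar frame has
entries `m (m - 1) F`, `(m - 1) F'` and `C`; the direction at angle `-ψ` from the radial one has
coordinates `(cos ψ, -sin ψ)` in this frame. -/
theorem secondForm_polar (r a ψ : ℝ) : secondForm f (polar r a) (polar 1 (a - ψ)) =
    r ^ (m - 1 - 1) * (m * (m - 1) * circleTrace f a * Real.cos ψ ^ 2 -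
      2 * ((m - 1) * circleDeriv f a) * Real.cos ψ * Real.sin ψ +
        circleHess f a * Real.sin ψ ^ 2) := by
  rw [circleTrace_eq hf hm, circleDeriv_eq hf hm, secondForm, hess_polar hf r, hess_polar hf r,
    hess_polar hf r, circleHess, secondForm]
  generalize hess f (polar 1 a) 0 0 = x
  generalize hess f (polar 1 a) 0 1 = y
  generalize hess f (polar 1 a) 1 1 = z
  simp only [polar, one_mul, Matrix.cons_val_zero, Matrix.cons_val_one, Matrix.cons_val_fin_one,
    Real.cos_sub, Real.sin_sub]
  ring

theorem crossForm_polar (r a ψ : ℝ) : crossForm f (polar r a) (polar 1 (a - ψ)) =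
    r ^ (m - 1 - 1) * ((m * (m - 1) * circleTrace f a - circleHess f a) * Real.cos ψ * Real.sin ψ +
      (m - 1) * circleDeriv f a * (Real.cos ψ ^ 2 - Real.sin ψ ^ 2)) := by
  rw [circleTrace_eq hf hm, circleDeriv_eq hf hm, crossForm, hess_polar hf r, hess_polar hf r,
    hess_polar hf r, circleHess, secondForm]
  generalize hess f (polar 1 a) 0 0 = x
  generalize hess f (polar 1 a) 0 1 = y
  generalize hess f (polar 1 a) 1 1 = z
  simp only [polar, one_mul, Matrix.cons_val_zero, Matrix.cons_val_one, Matrix.cons_val_fin_one,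
    Real.cos_sub, Real.sin_sub]
  ring

theorem isHyperbolicTrace (hh : IsHyperbolicPoly f) :
    IsHyperbolicTrace m (circleTrace f) (circleDeriv f) (circleHess f) := by
  have hpolar : ∀ a i, HasDerivAt (fun s => polar 1 s i) (![-Real.sin a, Real.cos a] i) a := by
    intro a i
    fin_cases i
    · simpa [polar] using Real.hasDerivAt_cos a
    · simpa [polar] using Real.hasDerivAt_sin a
  have hper : ∀ a, polar 1 (a + 2 * Real.pi) = polar 1 a := fun a => by
    simp [polar]
  have hc : Continuous fun a => polar 1 a :=
    continuous_polar.comp (continuous_const.prodMk continuous_id)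
  refine ⟨by exact_mod_cast hm, fun a => ?_, fun a => ?_, ?_, fun a => ?_, fun a => ?_, fun a => ?_,
    fun a => ?_⟩
  · refine (MvPolynomial.hasDerivAt_eval (f := f) (hpolar a)).congr_deriv ?_
    simp [circleDeriv]
    ring
  · have h0 := MvPolynomial.hasDerivAt_eval (f := MvPolynomial.pderiv 0 f) (hpolar a)
    have h1 := MvPolynomial.hasDerivAt_eval (f := MvPolynomial.pderiv 1 f) (hpolar a)
    refine ((h1.mul (Real.hasDerivAt_cos a)).sub (h0.mul (Real.hasDerivAt_sin a))).congr_deriv ?_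
    -- Differentiating the unit tangent produces the radial derivative with a minus sign, which
    -- Euler's identity turns into the term `-m F`.
    have h3 := eval_euler hf (polar 1 a)
    have h4 := hess_comm f (polar 1 a)
    simp only [hess, Matrix.of_apply] at h4
    simp only [circleTrace, circleHess, secondForm, hess, Matrix.of_apply, h4, Matrix.cons_val_zero,
      Matrix.cons_val_one, Matrix.cons_val_fin_one, ← h3]
    simp only [polar, one_mul, Matrix.cons_val_zero, Matrix.cons_val_one, Matrix.cons_val_fin_one]
    ring
  · have h0 := (continuous_hess f 0 0).comp hc
    have h1 := (continuous_hess f 0 1).comp hc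
    have h2 := (continuous_hess f 1 1).comp hc
    simp only [Function.comp_def] at h0 h1 h2
    unfold circleHess secondForm
    simp only [Matrix.cons_val_zero, Matrix.cons_val_one, Matrix.cons_val_fin_one]
    fun_prop
  · rw [circleTrace, hper, circleTrace]
  · rw [circleDeriv, hper, Real.cos_add_two_pi, Real.sin_add_two_pi, circleDeriv]
  · rw [circleHess, hper, Real.cos_add_two_pi, Real.sin_add_two_pi, circleHess]
  · have h1 := hh (polar 1 a) (polar_ne_zero one_pos a)
    rw [circleTrace_eq hf hm, circleDeriv_eq hf hm]
    refine h1.trans_eq ?_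
    simp only [discr, circleHess, secondForm, Matrix.cons_val_zero, Matrix.cons_val_one,
      Matrix.cons_val_fin_one]
    have h2 := Real.sin_sq_add_cos_sq a
    generalize hess f (polar 1 a) 0 0 = x
    generalize hess f (polar 1 a) 0 1 = y
    generalize hess f (polar 1 a) 1 1 = z
    -- The discriminant is invariant under rotation to the polar frame: the two sides differ by the
    -- factor `(sin² + cos²) ^ 2`.
    linear_combination (-(y ^ 2 - x * z) * (Real.sin a ^ 2 + Real.cos a ^ 2 + 1)) * h2

end

/-! ### Fields of asymptotic lines: classification and existence. -/

/-- On a null vector the last term drops out, so at a hyperbolic point `crossForm` does not vanish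
on nonzero null vectors and its sign can tell the two null lines apart. -/
theorem crossForm_sq (f : MvPolynomial (Fin 2) ℝ) (p v : Plane) :
    crossForm f p v ^ 2 = discr f p * (v 0 ^ 2 + v 1 ^ 2) ^ 2 + secondForm f p v *
      (hess f p 0 0 * v 1 ^ 2 - 2 * hess f p 0 1 * v 0 * v 1 + hess f p 1 1 * v 0 ^ 2) := by
  simp only [crossForm, discr, secondForm]
  ring

theorem crossForm_smul (f : MvPolynomial (Fin 2) ℝ) (p v : Plane) (c : ℝ) :
    crossForm f p (c • v) = c ^ 2 * crossForm f p v := by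
  simp only [crossForm, Pi.smul_apply, smul_eq_mul]
  ring

/-- Two null vectors at which `crossForm` has the same sign are parallel. -/
theorem parallel_of_null {f : MvPolynomial (Fin 2) ℝ} {p v w : Plane}
    (hv : secondForm f p v = 0) (hw : secondForm f p w = 0)
    (h : 0 < crossForm f p v * crossForm f p w) : v 0 * w 1 = v 1 * w 0 := by
  by_contra hne
  -- `S` is the polar form at `(v, w)`. Expanding `|v|² w` in `v` and `v` turned by a right angle,
  -- and likewise with `v` and `w` exchanged, expresses `S` by each `crossForm`, with determinants
  -- of opposite signs. The product of the two relations contradicts equal signs.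
  set S := hess f p 0 0 * v 0 * w 0 + hess f p 0 1 * (v 0 * w 1 + v 1 * w 0) +
    hess f p 1 1 * v 1 * w 1 with hS
  have h1 : (v 0 * w 1 - v 1 * w 0) * crossForm f p v = (v 0 ^ 2 + v 1 ^ 2) * S := by
    have : (v 0 * w 1 - v 1 * w 0) * crossForm f p v =
        (v 0 ^ 2 + v 1 ^ 2) * S - (v 0 * w 0 + v 1 * w 1) * secondForm f p v := by
      simp only [hS, crossForm, secondForm]
      ring
    rw [this, hv, mul_zero, sub_zero]
  have h2 : -(v 0 * w 1 - v 1 * w 0) * crossForm f p w = (w 0 ^ 2 + w 1 ^ 2) * S := by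
    have : -(v 0 * w 1 - v 1 * w 0) * crossForm f p w =
        (w 0 ^ 2 + w 1 ^ 2) * S - (v 0 * w 0 + v 1 * w 1) * secondForm f p w := by
      simp only [hS, crossForm, secondForm]
      ring
    rw [this, hw, mul_zero, sub_zero]
  have h3 : 0 < (v 0 * w 1 - v 1 * w 0) ^ 2 := by
    have := sub_ne_zero.2 hne
    positivity
  have h4 : (v 0 * w 1 - v 1 * w 0) ^ 2 * (crossForm f p v * crossForm f p w) =
      -((v 0 ^ 2 + v 1 ^ 2) * (w 0 ^ 2 + w 1 ^ 2) * S ^ 2) := by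
    linear_combination (-(-(v 0 * w 1 - v 1 * w 0) * crossForm f p w)) * h1 -
      ((v 0 ^ 2 + v 1 ^ 2) * S) * h2
  have h5 := mul_pos h3 h
  have h6 : 0 ≤ (v 0 ^ 2 + v 1 ^ 2) * (w 0 ^ 2 + w 1 ^ 2) * S ^ 2 := by positivity
  linarith

theorem sq_add_sq_pos {v : Plane} (hv : v ≠ 0) : 0 < v 0 ^ 2 + v 1 ^ 2 := by
  have h : v 0 ≠ 0 ∨ v 1 ≠ 0 := by
    by_contra! h
    refine hv ?_
    ext i
    fin_cases i
    · exact h.1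
    · exact h.2
  rcases h with h | h <;> positivity

/-- A field of asymptotic lines is one of the two which are distinguished by the sign of
`crossForm`. -/
theorem IsAsymptoticField.exists_sign {f : MvPolynomial (Fin 2) ℝ} (hf : IsHyperbolicPoly f)
    {L : Plane → Submodule ℝ Plane} (hL : IsAsymptoticField f L) :
    ∃ ε : ℝ, ε ^ 2 = 1 ∧ ∀ p : Plane, p ≠ 0 →
      ∃ w : Plane, w ≠ 0 ∧ L p = Submodule.span ℝ {w} ∧ secondForm f p w = 0 ∧
        0 < ε * crossForm f p w := by
  have hgen : ∀ p : Plane, ∃ w : Plane, p ≠ 0 → w ≠ 0 ∧ L p = Submodule.span ℝ {w} := by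
    intro p
    by_cases hp : p = 0
    · exact ⟨0, fun h => absurd hp h⟩
    · obtain ⟨U, hU, v, -, hv⟩ := hL.1 p hp
      exact ⟨v p, fun _ => hv p (mem_of_mem_nhds hU)⟩
  choose w hw using hgen
  have hnull : ∀ p ≠ 0, secondForm f p (w p) = 0 := fun p hp =>
    hL.2 p hp _ ((hw p hp).2 ▸ Submodule.mem_span_singleton_self _)
  -- The quotient is unchanged when `w p` is rescaled, so it is continuous although `w` is an
  -- arbitrary choice of generators.
  set g : Plane → ℝ := fun p => crossForm f p (w p) / (w p 0 ^ 2 + w p 1 ^ 2) with hg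
  have hgc : ContinuousOn g {0}ᶜ := by
    intro p hp
    obtain ⟨U, hU, v, hvc, hv⟩ := hL.1 p hp
    have h0 := hvc.continuousAt hU
    have hi : ∀ i, ContinuousAt (fun q => v q i) p := fun i =>
      ContinuousAt.comp (f := v) (continuous_apply i).continuousAt h0
    have hne := (sq_add_sq_pos (hv p (mem_of_mem_nhds hU)).1).ne'
    have h1 : ContinuousAt (fun q => crossForm f q (v q) / (v q 0 ^ 2 + v q 1 ^ 2)) p := by
      unfold crossForm
      have c0 := (continuous_hess f 0 0).continuousAt (x := p)
      have c1 := (continuous_hess f 0 1).continuousAt (x := p)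
      have c2 := (continuous_hess f 1 1).continuousAt (x := p)
      exact ((((c2.sub c0).mul (hi 0)).mul (hi 1)).add
        (c1.mul (((hi 0).pow 2).sub ((hi 1).pow 2)))).div (((hi 0).pow 2).add ((hi 1).pow 2)) hne
    refine (h1.congr ?_).continuousWithinAt
    filter_upwards [hU, isOpen_compl_singleton.mem_nhds hp] with q hqU hq0
    obtain ⟨hw0, hwL⟩ := hw q hq0
    obtain ⟨hv0, hvL⟩ := hv q hqU
    have hmem : w q ∈ Submodule.span ℝ {v q} := by
      rw [← hvL, hwL]
      exact Submodule.mem_span_singleton_self _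
    obtain ⟨c, hc⟩ := Submodule.mem_span_singleton.1 hmem
    have hc0 : c ≠ 0 := fun h => hw0 (by rw [← hc, h, zero_smul])
    have hvp := (sq_add_sq_pos hv0).ne'
    simp only [hg, ← hc, crossForm_smul, Pi.smul_apply, smul_eq_mul, mul_pow, ← mul_add]
    rw [mul_div_mul_left _ _ (pow_ne_zero 2 hc0)]
  have hdc : ContinuousOn (fun p => √(discr f p)) {0}ᶜ := by
    unfold discr
    have c0 := continuous_hess f 0 0
    have c1 := continuous_hess f 0 1
    have c2 := continuous_hess f 1 1
    exact ((c1.pow 2).sub (c0.mul c2)).sqrt.continuousOn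
  have hsq : Set.EqOn (g ^ 2) ((fun p => √(discr f p)) ^ 2) {0}ᶜ := by
    intro p hp
    have h1 := crossForm_sq f p (w p)
    have h2 := (sq_add_sq_pos (hw p hp).1).ne'
    rw [hnull p hp, zero_mul, add_zero] at h1
    simp only [Pi.pow_apply, hg]
    rw [Real.sq_sqrt (hf p hp).le, div_pow, h1, mul_div_cancel_right₀ _ (pow_ne_zero 2 h2)]
  -- On the connected punctured plane, `g` and the nowhere zero square root of the discriminant have
  -- equal squares, so they agree up to one global sign.
  have hconn : IsPreconnected ({0}ᶜ : Set Plane) :=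
    (isConnected_compl_singleton_of_one_lt_rank (by simp) 0).isPreconnected
  have hmain : ∃ ε : ℝ, ε ^ 2 = 1 ∧ ∀ p ≠ 0, g p = ε * √(discr f p) := by
    rcases hconn.eq_or_eq_neg_of_sq_eq hgc hdc hsq
      (fun {p} hp => (Real.sqrt_pos.2 (hf p hp)).ne') with h | h
    · exact ⟨1, by norm_num, fun p hp => by rw [h hp, one_mul]⟩
    · exact ⟨-1, by norm_num, fun p hp => by rw [h hp, Pi.neg_apply, neg_one_mul]⟩
  obtain ⟨ε, hε, hεg⟩ := hmain
  refine ⟨ε, hε, fun p hp => ⟨w p, (hw p hp).1, (hw p hp).2, hnull p hp, ?_⟩⟩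
  have h1 := hεg p hp
  have h2 := sq_add_sq_pos (hw p hp).1
  have h3 := Real.sqrt_pos.2 (hf p hp)
  rw [hg, div_eq_iff h2.ne'] at h1
  have h4 : ε * crossForm f p (w p) = √(discr f p) * (w p 0 ^ 2 + w p 1 ^ 2) := by
    rw [h1, ← mul_assoc, ← mul_assoc, ← sq, hε, one_mul]
  rw [h4]
  positivity

theorem IsAsymptoticField.exists_phase {f : MvPolynomial (Fin 2) ℝ} {m : ℕ}
    (hfm : f.IsHomogeneous m) (hf : IsHyperbolicPoly f) {L : Plane → Submodule ℝ Plane}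
    (hL : IsAsymptoticField f L) {n : ℤ}
    (hn : HasWinding (jetCurve (circleTrace f) (circleDeriv f)) n) :
    ∃ Ψ, IsPhase Ψ (-n) ∧ HasRadialAngle L Ψ := by
  have hm := two_le_of_isHyperbolicPoly hfm hf
  obtain ⟨ε, hε, hεL⟩ := hL.exists_sign hf
  obtain ⟨Ψ, hΨ, hnull⟩ := (isHyperbolicTrace hfm hm hf).exists_phase hn hε
  refine ⟨Ψ, hΨ, fun r a hr => ?_⟩
  obtain ⟨w, hw0, hwL, hw1, hw2⟩ := hεL _ (polar_ne_zero hr a)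
  obtain ⟨h1, h2⟩ := hnull a
  have hv1 := secondForm_polar hfm hm r a (Ψ a)
  have hv2 := crossForm_polar hfm hm r a (Ψ a)
  rw [h1, mul_zero] at hv1
  have hv3 : 0 < ε * crossForm f (polar r a) (polar 1 (a - Ψ a)) := by
    rw [hv2, mul_left_comm]
    exact mul_pos (pow_pos hr _) h2
  have hpar := parallel_of_null hw1 hv1 (by
    have := mul_pos hw2 hv3
    have h5 : ε * crossForm f (polar r a) w * (ε * crossForm f (polar r a) (polar 1 (a - Ψ a))) =
      ε ^ 2 * (crossForm f (polar r a) w * crossForm f (polar r a) (polar 1 (a - Ψ a))) := by ring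
    rwa [h5, hε, one_mul] at this)
  have hmem : w ∈ Submodule.span ℝ {polar 1 (a - Ψ a)} := by
    rw [mem_span_polar_iff]
    simpa [polar] using hpar
  obtain ⟨c, rfl⟩ := Submodule.mem_span_singleton.1 hmem
  have hc : c ≠ 0 := fun h => hw0 (by rw [h, zero_smul])
  rw [hwL]
  exact Submodule.span_singleton_smul_eq (IsUnit.mk0 c hc) _

/-- One of the two fields of asymptotic lines. -/
noncomputable def asymptoticField (f : MvPolynomial (Fin 2) ℝ) (p : Plane) :
    Submodule ℝ Plane where
  carrier := {v | hess f p 0 0 * v 0 + (hess f p 0 1 - √(discr f p)) * v 1 = 0 ∧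
    (hess f p 0 1 + √(discr f p)) * v 0 + hess f p 1 1 * v 1 = 0}
  add_mem' := by
    rintro v w ⟨h1, h2⟩ ⟨h3, h4⟩
    constructor
    · simp only [Pi.add_apply]
      linear_combination h1 + h3
    · simp only [Pi.add_apply]
      linear_combination h2 + h4
  zero_mem' := by simp
  smul_mem' := by
    rintro c v ⟨h1, h2⟩
    constructor
    · simp only [Pi.smul_apply, smul_eq_mul]
      linear_combination c * h1
    · simp only [Pi.smul_apply, smul_eq_mul]
      linear_combination c * h2

/-- The two equations are the rows of the Hessian with `√(discr f p)` subtracted from one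
off-diagonal entry and added to the other. This leaves the quadratic form unchanged and makes the
determinant zero. The off-diagonal entries differ by `2 √(discr f p) > 0`, so the matrix has rank
one, and a row with nonzero off-diagonal entry gives a continuous local generator of the kernel. -/
theorem isAsymptoticField_asymptoticField {f : MvPolynomial (Fin 2) ℝ}
    (hf : IsHyperbolicPoly f) : IsAsymptoticField f (asymptoticField f) := by
  have c0 := continuous_hess f 0 0
  have c1 := continuous_hess f 0 1
  have c2 := continuous_hess f 1 1
  have cd : Continuous fun p => √(discr f p) := ((c1.pow 2).sub (c0.mul c2)).sqrt
  have hsq : ∀ p ≠ 0, √(discr f p) ^ 2 = hess f p 0 1 ^ 2 - hess f p 0 0 * hess f p 1 1 :=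
    fun p hp => Real.sq_sqrt (hf p hp).le
  refine ⟨fun p hp => ?_, fun p hp v hv => ?_⟩
  · rcases lt_or_ge (hess f p 0 1) (√(discr f p)) with hlt | hge
    · refine ⟨_, Filter.inter_mem (isOpen_compl_singleton.mem_nhds hp)
        ((isOpen_lt c1 cd).mem_nhds hlt),
        fun q => ![√(discr f q) - hess f q 0 1, hess f q 0 0], ?_, ?_⟩
      · refine (continuous_pi fun i => ?_).continuousOn
        fin_cases i
        · exact cd.sub c1
        · exact c0
      · rintro q ⟨hq0, hq⟩
        have hpos : 0 < √(discr f q) - hess f q 0 1 := sub_pos.2 hq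
        have hs := hsq q hq0
        refine ⟨fun h => hpos.ne' (congrFun h 0), le_antisymm ?_ ?_⟩
        · rintro v ⟨h1, -⟩
          refine Submodule.mem_span_singleton.2 ⟨v 0 / (√(discr f q) - hess f q 0 1), ?_⟩
          ext i
          fin_cases i
          · simp [div_mul_cancel₀ _ hpos.ne']
          · simp only [Fin.mk_one, Pi.smul_apply, Matrix.cons_val_one, Matrix.cons_val_fin_one,
              smul_eq_mul]
            rw [div_mul_eq_mul_div, div_eq_iff hpos.ne']
            linear_combination h1
        · rw [Submodule.span_singleton_le_iff_mem]
          constructor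
          · simp only [Matrix.cons_val_zero, Matrix.cons_val_one, Matrix.cons_val_fin_one]
            ring
          · simp only [Matrix.cons_val_zero, Matrix.cons_val_one, Matrix.cons_val_fin_one]
            linear_combination hs
    · have hpos : 0 < hess f p 0 1 + √(discr f p) := by
        have := Real.sqrt_pos.2 (hf p hp)
        linarith
      refine ⟨_, Filter.inter_mem (isOpen_compl_singleton.mem_nhds hp)
        ((isOpen_lt continuous_const (c1.add cd)).mem_nhds hpos),
        fun q => ![hess f q 1 1, -(hess f q 0 1 + √(discr f q))], ?_, ?_⟩
      · refine (continuous_pi fun i => ?_).continuousOn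
        fin_cases i
        · exact c2
        · exact (c1.add cd).neg
      · rintro q ⟨hq0, hq⟩
        have hpos : 0 < hess f q 0 1 + √(discr f q) := hq
        have hs := hsq q hq0
        refine ⟨fun h => hpos.ne' (neg_eq_zero.1 (congrFun h 1)), le_antisymm ?_ ?_⟩
        · rintro v ⟨-, h2⟩
          refine Submodule.mem_span_singleton.2 ⟨-v 1 / (hess f q 0 1 + √(discr f q)), ?_⟩
          ext i
          fin_cases i
          · simp only [Fin.zero_eta, Pi.smul_apply, Matrix.cons_val_zero, smul_eq_mul]
            rw [div_mul_eq_mul_div, div_eq_iff hpos.ne']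
            linear_combination (-1 : ℝ) * h2
          · simp only [Fin.mk_one, Pi.smul_apply, Matrix.cons_val_one, Matrix.cons_val_fin_one,
              smul_eq_mul]
            rw [mul_neg, div_mul_cancel₀ _ hpos.ne', neg_neg]
        · rw [Submodule.span_singleton_le_iff_mem]
          constructor
          · simp only [Matrix.cons_val_zero, Matrix.cons_val_one, Matrix.cons_val_fin_one]
            linear_combination hs
          · simp only [Matrix.cons_val_zero, Matrix.cons_val_one, Matrix.cons_val_fin_one]
            ring
  · obtain ⟨h1, h2⟩ := hv
    rw [secondForm]
    linear_combination v 0 * h1 + v 1 * h2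

/-! ### The comparison of `P` and `P * Q`. -/

theorem corollary3p2 (P Q : MvPolynomial (Fin 2) ℝ) (m k : ℕ)
    (hPm : P.IsHomogeneous m) (hQk : Q.IsHomogeneous k)
    (hP : IsHyperbolicPoly P) (hQ : IsEllipticPoly Q) (hf : IsHyperbolicPoly (P * Q))
    (hQpos : ∀ p : Plane, p ≠ 0 → 0 < MvPolynomial.eval p Q)
    (hineq : ∀ p : Plane, hessPairing P Q p ≤ 0) :
    (∃ L, IsAsymptoticField (P * Q) L) ∧ (∃ M, IsAsymptoticField P M) ∧
      ∀ L M : Plane → Submodule ℝ Plane, IsAsymptoticField (P * Q) L → IsAsymptoticField P M →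
        TopEquivalent L M ∧
          ∃ n : ℤ, HasIndex L ((n : ℝ) / 2) ∧ HasIndex M ((n : ℝ) / 2) := by
  refine ⟨⟨_, isAsymptoticField_asymptoticField hf⟩, ⟨_, isAsymptoticField_asymptoticField hP⟩,
    fun L M hL hM => ?_⟩
  have hPt := isHyperbolicTrace hPm (two_le_of_isHyperbolicPoly hPm hP) hP
  have hft := isHyperbolicTrace (hPm.mul hQk) (two_le_of_isHyperbolicPoly (hPm.mul hQk) hf) hf
  obtain ⟨n, hn⟩ := hPt.exists_hasWinding_jetCurve
  -- The winding numbers agree, so both fields below have phases with the same increment `-n * π`,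
  -- whichever of the two asymptotic fields of each polynomial was given.
  have hn' := hasWinding_jetCurve_mul hPt hn hft (q := circleTrace Q)
    (fun a => hQpos _ (polar_ne_zero one_pos a)) (circleTrace_mul P Q) (circleDeriv_mul P Q)
  have hN := hPt.winding_neg hn
  obtain ⟨Ψ, hΨ, hLΨ⟩ := hL.exists_phase (hPm.mul hQk) hf hn'
  obtain ⟨Φ, hΦ, hMΦ⟩ := hM.exists_phase hPm hP hn
  exact ⟨(hLΨ.isHorizontalModel hΨ hN).topEquivalent (hMΦ.isHorizontalModel hΦ hN), _,
    hLΨ.hasIndex hΨ, hMΦ.hasIndex hΦ⟩
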